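/- Let $d\ge 1$, and let $C_+(\mathbb{R}^d)$ be the space of non-negative continuous functions on $\mathbb{R}^d$ with the topology of locally uniform convergence and its Borel $\sigma$-algebra. Let $\mathbb{P}_X$ be a probability measure on $C_+(\mathbb{R}^d)$ (the law of the storm process $X$), let $\mu_Y>0$, and let $\Psi$ be a random element of $C_+(\mathbb{R}^d)$ that is almost surely strictly positive on $\mathbb{R}^d$. Let $N=\sum_{i=1}^\infty\delta_{(s_i,u_i,X_i)}$ be a point process on $\mathbb{R}^d\times(0,\infty]\times C_+(\mathbb{R}^d)$ which, conditionally on $\Psi=\psi$, is a Poisson process with directing measure $\mu_Y^{-1}\psi(s)\,ds\,u^{-2}\,du\,d\mathbb{P}_X$, and put $$Y(t)=\bigvee_{i=1}^\infty u_iX_i(t-s_i),\qquad t\in\mathbb{R}^d .$$ Here a point process is a random simple counting measure that is finite on compact sets. A Poisson process with (locally finite) directing measure $\lambda$ is a point process whose number of points in $B$ is Poisson distributed with parameter $\lambda(B)$ for every Borel set $B$ with $\lambda(B)<\infty$, and whose numbers of points in disjoint Borel sets are independent. A Cox process directed by a random measure $\Lambda$ is a point process which, conditionally on $\Lambda=\lambda$,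 is a Poisson process with directing measure $\lambda$. Assume that there are constants $C,R>0$ with $X\le C\,\mathbf 1_{B_R(o)}$ $\mathbb{P}_X$-almost surely, where $B_R(o)$ is the closed ball of radius $R$ centred at the origin $o$, and that there is $r>0$ with $\mathbb{P}_X\big(B_r(o)\subset\{s: X(s)>0\}\big)>0$. Let $Y^*$ be a random element of $C_+(\mathbb{R}^d)$ which, conditionally on $\Psi$, has the same law (as a random field) as $Y$ and is independent of $N$. Let $K\subset\mathbb{R}^d$ be compact, let $K_R=K\oplus B_R(o)$, and let $$N_K^{Y^*}=\sum_{i=1}^\infty\delta_{s_i}\mathbf 1\Big\{\sup_{t\in K}\frac{X_i(t-s_i)}{Y^*(t)}\ge u_i^{-1}\Big\},\qquad b_K^y(s)=\mu_Y^{-1}\,\mathbb{E}_X\Big[\sup_{t\in K}\frac{X(t-s)}{y(t)}\Big],\quad s\in\mathbb{R}^d .$$ Then $N_K^{Y^*}$ is a Cox process on $K_R$, that is, it is a Cox process directed by the random measure $b_K^{Y^*}(s)\Psi(s)\,ds$ and almost surely has no points outside $K_R$. More specifically, conditionally on $\Psi=\psi$ and $Y^*=y$ (for almost every $(\psi,y)$),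 $N_K^{Y^*}$ is a Poisson process with directing measure $b_K^y(s)\psi(s)\,ds$. Moreover the support of $b_K^y$ lies in $K_R$ for every $y$ (with $a/0=\infty$ for $a>0$, and $0/0=0$). -/

import Mathlib

open MeasureTheory ProbabilityTheory Set
open scoped NNReal ENNReal Pointwise

noncomputable section

namespace CoxExtremal

/-! ### Point processes, Poisson processes, Cox processes -/

/-- A locally finite simple counting measure: a sum of unit masses at the points of a countable
set, finite on compact sets. -/
structure IsSimpleCounting {S : Type*} [TopologicalSpace S] [MeasurableSpace S]
    (ν : Measure S) : Prop where
  exists_points : ∃ A : Set S, A.Countable ∧ ν = Measure.sum fun a : A => Measure.dirac (a : S)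
  finiteOnCompacts : IsFiniteMeasureOnCompacts ν

/-- `Q` is the law of a Poisson process with (locally finite) directing measure `lam`.
The space `Measure S` carries the `σ`-algebra generated by the evaluations `ν ↦ ν B`. -/
structure IsPoissonLaw {S : Type*} [TopologicalSpace S] [MeasurableSpace S]
    (lam : Measure S) (Q : Measure (Measure S)) : Prop where
  directing : IsFiniteMeasureOnCompacts lam
  isProbabilityMeasure : IsProbabilityMeasure Q
  simple : ∀ᵐ ν ∂Q, IsSimpleCounting ν
  counts : ∀ B : Set S, MeasurableSet B → lam B < ∞ →
    HasLaw (fun ν : Measure S => ν B)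
      ((poissonMeasure (lam B).toNNReal).map (fun k : ℕ => (k : ℝ≥0∞))) Q
  indep : ∀ (n : ℕ) (B : Fin n → Set S), (∀ i, MeasurableSet (B i)) →
    Pairwise (fun i j => Disjoint (B i) (B j)) →
    iIndepFun (fun (i : Fin n) (ν : Measure S) => ν (B i)) Q

/-- `N | Z = z ∼ PP(dir z)`: there is a regular conditional distribution of `N` given `Z` which,
for almost every value `z` of `Z`, is the law of a Poisson process directed by `dir z`. -/
def IsCondPoisson {Ω S 𝓩 : Type*} [MeasurableSpace Ω] [TopologicalSpace S] [MeasurableSpace S]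
    [MeasurableSpace 𝓩] (N : Ω → Measure S) (Z : Ω → 𝓩) (dir : 𝓩 → Measure S)
    (P : Measure Ω) : Prop :=
  ∃ κ : Kernel 𝓩 (Measure S), IsMarkovKernel κ ∧
    (∀ᵐ z ∂(P.map Z), IsPoissonLaw (dir z) (κ z)) ∧ HasCondDistrib N Z κ P

/-- `N ∼ CP(Lam)`: conditionally on the random measure `Lam`, `N` is a Poisson process directed
by `Lam`. -/
def IsCoxProcess {Ω S : Type*} [MeasurableSpace Ω] [TopologicalSpace S] [MeasurableSpace S]
    (N : Ω → Measure S) (Lam : Ω → Measure S) (P : Measure Ω) : Prop :=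
  IsCondPoisson N Lam id P

/-- Conditional independence of two `σ`-algebras `m₁`, `m₂` given `m`, through conditional
probabilities (no regularity of the underlying space is needed). -/
def CondIndepGiven {Ω : Type*} (m m₁ m₂ : MeasurableSpace Ω) {_mΩ : MeasurableSpace Ω}
    (P : Measure Ω) : Prop :=
  ∀ A B : Set Ω, MeasurableSet[m₁] A → MeasurableSet[m₂] B →
    P⟦A ∩ B | m⟧ =ᵐ[P] P⟦A | m⟧ * P⟦B | m⟧

/-! ### Cox extremal processes -/

/-- `ℝ^d`. -/
abbrev Loc (d : ℕ) : Type := EuclideanSpace ℝ (Fin d)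

/-- Non-negative continuous functions on `ℝ^d`, with the topology of locally uniform
convergence. -/
abbrev Path (d : ℕ) : Type := C(Loc d, ℝ≥0)

/-- The Borel `σ`-algebra of the topology of locally uniform convergence. -/
instance (d : ℕ) : MeasurableSpace (Path d) := borel (Path d)

instance (d : ℕ) : BorelSpace (Path d) := ⟨rfl⟩

/-- The interval `(0, ∞]`. -/
abbrev Severity : Type := Ioi (0 : ℝ≥0∞)

/-- The space `ℝ^d × (0, ∞] × C(ℝ^d)` of triples (centre, severity, shape). -/
abbrev Storm (d : ℕ) : Type := Loc d × Severity × Path d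

/-- The measure `u⁻² du` on `(0, ∞]` (no mass at `∞`). -/
def severityMeasure : Measure Severity :=
  (((volume.restrict (Ioi (0 : ℝ))).withDensity fun u => ENNReal.ofReal ((u ^ 2)⁻¹)).map
    ENNReal.ofReal).comap Subtype.val

/-- The measure `μ⁻¹ ψ(s) ds u⁻² du dP_X` on storms. -/
def stormIntensity {d : ℕ} (μ : ℝ≥0) (PX : Measure (Path d)) (ψ : Path d) : Measure (Storm d) :=
  (volume.withDensity fun s : Loc d => (μ : ℝ≥0∞)⁻¹ * (ψ s : ℝ≥0∞)).prod
    (severityMeasure.prod PX)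

/-- The point process `N = ∑ᵢ δ_(sᵢ, uᵢ, Xᵢ)` of a sequence of storms. -/
def stormProcess {Ω : Type*} {d : ℕ} (ξ : ℕ → Ω → Storm d) (ω : Ω) : Measure (Storm d) :=
  Measure.sum fun i => Measure.dirac (ξ i ω)

/-- The random field `Y(t) = ⋁ᵢ uᵢ Xᵢ(t - sᵢ)`. -/
def extremalField {Ω : Type*} {d : ℕ} (ξ : ℕ → Ω → Storm d) (ω : Ω) (t : Loc d) : ℝ≥0∞ :=
  ⨆ i, ((ξ i ω).2.1 : ℝ≥0∞) * ((ξ i ω).2.2 (t - (ξ i ω).1) : ℝ≥0∞)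

/-- `sup_{t ∈ K} f(t - s) / y(t)`. -/
def supRatio {d : ℕ} (K : Set (Loc d)) (y f : Path d) (s : Loc d) : ℝ≥0∞ :=
  ⨆ t ∈ K, (f (t - s) : ℝ≥0∞) / (y t : ℝ≥0∞)

open scoped Classical in
/-- The point process `N_K^{Y*} = ∑ᵢ δ_{sᵢ} 1{sup_{t ∈ K} Xᵢ(t - sᵢ) Y*(t)⁻¹ ≥ uᵢ⁻¹}` of the
contributing storm centres. -/
def contributingCentres {Ω : Type*} {d : ℕ} (ξ : ℕ → Ω → Storm d) (K : Set (Loc d))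
    (Ystar : Ω → Path d) (ω : Ω) : Measure (Loc d) :=
  Measure.sum fun i =>
    if ((ξ i ω).2.1 : ℝ≥0∞)⁻¹ ≤ supRatio K (Ystar ω) (ξ i ω).2.2 (ξ i ω).1
    then Measure.dirac (ξ i ω).1 else 0

/-- `b_K^y(s) = μ⁻¹ E_X [sup_{t ∈ K} X(t - s) / y(t)]`. -/
def correctingFactor {d : ℕ} (μ : ℝ≥0) (PX : Measure (Path d)) (K : Set (Loc d)) (y : Path d)
    (s : Loc d) : ℝ≥0∞ :=
  (μ : ℝ≥0∞)⁻¹ * ∫⁻ f, supRatio K y f s ∂PX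

/-- The measure `b_K^y(s) ψ(s) ds`. -/
def centreIntensity {d : ℕ} (μ : ℝ≥0) (PX : Measure (Path d)) (K : Set (Loc d))
    (ψ y : Path d) : Measure (Loc d) :=
  volume.withDensity fun s => correctingFactor μ PX K y s * (ψ s : ℝ≥0∞)

end CoxExtremal

end

/-! Under `u⁻² du` the set of severities with `u⁻¹ ≤ h` has mass exactly `h`
(`severityMeasure_inv_le`). A storm contributes on `K` to `y` precisely when `u⁻¹` is at most its
supremum ratio, so integrating out the severity and then the shape turns the intensity of the
contributing storms into `b_K^y(s) ψ(s) ds` (`stormIntensity_apply`, `map_restrict_contributing`).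
By conditional independence `N` remains Poisson when `Y* = y` is added to the conditioning
(`hasCondDistrib_of_condIndepGiven`), and the contributing centres arise from `N` by restriction and
projection, which preserve Poisson processes (`IsPoissonLaw.map_restrict`). Counts and independence
pass to the image at once. Simplicity does not, because a projection can merge points; it is
recovered from the Poisson counts and the absence of atoms in the image intensity
(`ae_mem_simpleHull`).

The directing measure is locally finite only if `Y*` is bounded away from zero on `K`. Near every
point there are almost surely storms positive around their centres, so `Y`, and with it its
continuous copy `Y*`, is strictly positive (`ae_forall_pos_of_identDistrib`).

The Cox statement conditions on the directing measure alone, so Poisson laws are needed as a kernel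
in that measure. One fixed storm process is thinned at a level depending measurably on the desired
measure `lam`, chosen so that its centres are directed by `lam` (`map_restrict_keptStorms`).
Uniqueness of Poisson laws (`IsPoissonLaw.unique`) identifies this kernel with the conditional law
given `(Ψ, Y*)`, which therefore depends on `(Ψ, Y*)` only through the directing measure
(`isCoxProcess_of_hasCondDistrib`). -/

noncomputable section

namespace CoxExtremal

open Filter Topology MeasurableSpace

/-! ### Dyadic cells of a countably generated space -/

section Cells

variable {T : Type*} [MeasurableSpace T] [CountablyGenerated T]

/-- The atom of the first `n` generating sets with membership pattern `σ`. -/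
def cell (T : Type*) [MeasurableSpace T] [CountablyGenerated T] (n : ℕ) (σ : Fin n → Bool) :
    Set T :=
  {x | ∀ i : Fin n, mapNatBool T x i = σ i}

/-- The atom of the first `n` generating sets which contains `x`. -/
def cellAt (n : ℕ) (x : T) : Set T := cell T n fun i => mapNatBool T x i

lemma measurableSet_cell (n : ℕ) (σ : Fin n → Bool) : MeasurableSet (cell T n σ) := by
  have : cell T n σ = ⋂ i : Fin n, (fun x => mapNatBool T x i) ⁻¹' {σ i} := by
    ext x; simp [cell]
  rw [this]
  exact MeasurableSet.iInter fun i =>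
    ((measurable_pi_apply _).comp (measurable_mapNatBool T)) (measurableSet_singleton _)

lemma mem_cellAt (n : ℕ) (x : T) : x ∈ cellAt n x := fun _ => rfl

lemma antitone_cellAt (x : T) : Antitone fun n => cellAt n x := fun _ _ hnm _ hy i =>
  hy (Fin.castLE hnm i)

lemma iInter_cellAt [SeparatesPoints T] (x : T) : ⋂ n, cellAt n x = {x} := by
  ext y
  simp only [mem_iInter, mem_singleton_iff]
  refine ⟨fun h => injective_mapNatBool T (funext fun k => ?_), fun h n => h ▸ mem_cellAt n y⟩
  exact h (k + 1) ⟨k, Nat.lt_succ_self k⟩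

lemma tendsto_measure_cellAt [SeparatesPoints T] (ν : Measure T) [IsFiniteMeasure ν] (x : T) :
    Tendsto (fun n => ν (cellAt n x)) atTop (𝓝 (ν {x})) := by
  rw [← iInter_cellAt x]
  exact tendsto_measure_iInter_atTop (fun n => (measurableSet_cell n _).nullMeasurableSet)
    (antitone_cellAt x) ⟨0, measure_ne_top _ _⟩

/-- For a finite measure without atoms the sum of the squared masses of the cells vanishes in the
limit. -/
lemma tendsto_sum_sq_measure_cell [SeparatesPoints T] (ν : Measure T) [IsFiniteMeasure ν]
    (h0 : ∀ x, ν {x} = 0) :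
    Tendsto (fun n => ∑ σ : Fin n → Bool, ν (cell T n σ) ^ 2) atTop (𝓝 0) := by
  have hval : ∀ n (x : T),
      ∑ σ : Fin n → Bool, (cell T n σ).indicator (fun _ => ν (cell T n σ)) x
        = ν (cellAt n x) := by
    intro n x
    rw [Finset.sum_eq_single fun i : Fin n => mapNatBool T x i]
    · exact indicator_of_mem (mem_cellAt n x) _
    · intro σ _ hσ
      exact indicator_of_notMem (fun hx => hσ (funext fun i => (hx i).symm)) _
    · simp
  -- The sum of squares is the `ν`-average of the mass of the cell around a point, and that mass
  -- tends to `ν {x} = 0`; dominated convergence finishes.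
  have hint : ∀ n, ∫⁻ x, ν (cellAt n x) ∂ν = ∑ σ : Fin n → Bool, ν (cell T n σ) ^ 2 := by
    intro n
    simp_rw [← hval n]
    rw [lintegral_finsetSum _ fun σ _ => measurable_const.indicator (measurableSet_cell n σ)]
    refine Finset.sum_congr rfl fun σ _ => ?_
    rw [lintegral_indicator_const (measurableSet_cell n σ), sq]
  simp_rw [← hint]
  have hmeas : ∀ n, Measurable fun x : T => ν (cellAt n x) := by
    intro n
    simp_rw [← hval n]
    exact Finset.measurable_fun_sum _ fun σ _ =>
      measurable_const.indicator (measurableSet_cell n σ)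
  have := tendsto_lintegral_of_dominated_convergence (μ := ν) (F := fun n x => ν (cellAt n x))
    (f := fun _ => 0) (fun _ => ν univ) hmeas
    (fun n => Eventually.of_forall fun x => measure_mono (subset_univ _))
    (by simp [ENNReal.mul_eq_top])
    (Eventually.of_forall fun x => by simpa [h0 x] using tendsto_measure_cellAt ν x)
  simpa using this

end Cells

/-! ### Simple counting measures -/

section Counting

variable {S : Type*} [TopologicalSpace S] [MeasurableSpace S]

/-- Integrality of a finite measure on a generating `π`-system extends to all measurable sets. -/
lemma exists_nat_eq_of_isPiSystem {α : Type*} {m : MeasurableSpace α} {ν : Measure α}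
    [IsFiniteMeasure ν] {𝒞 : Set (Set α)} (hgen : m = generateFrom 𝒞) (hpi : IsPiSystem 𝒞)
    (huniv : ∃ n : ℕ, ν univ = n) (h : ∀ B ∈ 𝒞, ∃ n : ℕ, ν B = n) {B : Set α}
    (hB : MeasurableSet B) : ∃ n : ℕ, ν B = n := by
  induction B, hB using induction_on_inter hgen hpi with
  | empty => exact ⟨0, by simp⟩
  | basic t ht => exact h t ht
  | compl t ht ih =>
    obtain ⟨n, hn⟩ := huniv
    obtain ⟨k, hk⟩ := ih
    refine ⟨n - k, ?_⟩
    rw [measure_compl ht (measure_ne_top _ _), hn, hk, ENNReal.natCast_sub]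
  | iUnion f hd hm ih =>
    choose k hk using ih
    rw [measure_iUnion hd hm]
    have hfin : ∑' i, ν (f i) ≠ ∞ := by
      rw [← measure_iUnion hd hm]; exact measure_ne_top _ _
    simp_rw [hk] at hfin ⊢
    have hfs : (Function.support k).Finite := by
      have := ENNReal.finite_const_le_of_tsum_ne_top hfin one_ne_zero
      refine this.subset fun i hi => ?_
      simpa [Nat.one_le_iff_ne_zero] using hi
    refine ⟨∑ i ∈ hfs.toFinset, k i, ?_⟩
    rw [tsum_eq_sum (s := hfs.toFinset)]
    · simp
    · intro i hi
      simpa using hi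

/-- A measure which is integer valued and has at most unit atoms on each member of an exhaustion
is a simple counting measure. -/
lemma isSimpleCounting_of_exhaustion [CountablyGenerated S] [MeasurableSingletonClass S]
    {ν : Measure S} {E : ℕ → Set S}
    (hEK : ∀ C : Set S, IsCompact C → ∃ m, C ⊆ E m)
    (hfin : ∀ m, ν (E m) < ∞)
    (hint : ∀ m B, MeasurableSet B → ∃ n : ℕ, ν (B ∩ E m) = n)
    (hone : ∀ x, ν {x} ≤ 1) : IsSimpleCounting ν := by
  have hcov : ⋃ m, E m = univ := eq_univ_of_forall fun x => by
    obtain ⟨m, hm⟩ := hEK {x} isCompact_singleton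
    exact mem_iUnion.2 ⟨m, hm rfl⟩
  have hxE : ∀ x, ∃ m, x ∈ E m := fun x => mem_iUnion.1 (hcov ▸ mem_univ x)
  set A : Set S := {x | ν {x} ≠ 0} with hA
  have hAc : A.Countable := by
    have hsub : A ⊆ ⋃ m, {x | 0 < (ν.restrict (E m)) {a | id a = x}} := by
      intro x hx
      obtain ⟨m, hm⟩ := hxE x
      refine mem_iUnion.2 ⟨m, ?_⟩
      have : {a | id a = x} ∩ E m = {x} := by
        ext a; simp only [id, mem_inter_iff, mem_ofPred_eq, mem_singleton_iff]
        exact ⟨fun h => h.1, fun h => ⟨h, h ▸ hm⟩⟩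
      have hms : MeasurableSet {a | id a = x} := measurableSet_singleton x
      simp only [mem_ofPred_eq]
      rw [Measure.restrict_apply hms, this]
      exact pos_iff_ne_zero.2 hx
    refine Countable.mono hsub (countable_iUnion fun m => ?_)
    have : IsFiniteMeasure (ν.restrict (E m)) := ⟨by simpa using hfin m⟩
    exact Measure.countable_meas_level_set_pos measurable_id
  refine ⟨⟨A, hAc, ?_⟩, ⟨fun C hC => ?_⟩⟩
  · have hAm : MeasurableSet A := hAc.measurableSet
    have hA1 : ∀ x ∈ A, ν {x} = 1 := by
      intro x hx
      obtain ⟨m, hm⟩ := hxE x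
      obtain ⟨n, hn⟩ := hint m {x} (measurableSet_singleton x)
      rw [inter_eq_left.2 (singleton_subset_iff.2 hm)] at hn
      have h1 := hone x
      have h0 : ν {x} ≠ 0 := hx
      rw [hn] at h1 h0 ⊢
      have h1' : n ≤ 1 := by exact_mod_cast h1
      have h0' : n ≠ 0 := by exact_mod_cast h0
      have : n = 1 := by omega
      simp [this]
    have hdiff : ν Aᶜ = 0 := by
      have hm : ∀ m, ν (Aᶜ ∩ E m) = 0 := by
        intro m
        set ρ := ν.restrict (Aᶜ ∩ E m) with hρ
        have hρf : IsFiniteMeasure ρ :=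
          ⟨by simpa [hρ] using (measure_mono inter_subset_right).trans_lt (hfin m)⟩
        have hρat : ∀ x, ρ {x} = 0 := by
          intro x
          rw [hρ, Measure.restrict_apply (measurableSet_singleton x)]
          by_cases hx : x ∈ A
          · rw [show ({x} ∩ (Aᶜ ∩ E m) : Set S) = ∅ from ?_, measure_empty]
            ext y; simp only [mem_inter_iff, mem_singleton_iff, mem_compl_iff, mem_empty_iff_false,
              iff_false]
            rintro ⟨rfl, h, -⟩
            exact h hx
          · exact measure_mono_null inter_subset_left (not_not.1 hx)
        have hρint : ∀ B, MeasurableSet B → ∃ n : ℕ, ρ B = n := by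
          intro B hB
          rw [hρ, Measure.restrict_apply hB, ← inter_assoc]
          exact hint m _ (hB.inter hAm.compl)
        -- Off its atoms the measure vanishes: cells shrinking to a non-atom eventually have mass
        -- below one, hence zero by integrality, and there are only countably many cells to cover
        -- the space with.
        have hzero : ∀ x : S, ∃ n, ρ (cellAt n x) = 0 := by
          intro x
          have h1 := tendsto_measure_cellAt ρ x
          rw [hρat x] at h1
          obtain ⟨n, hn⟩ := (h1.eventually (gt_mem_nhds (zero_lt_one (α := ℝ≥0∞)))).exists
          obtain ⟨k, hk⟩ := hρint (cellAt n x) (measurableSet_cell n _)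
          refine ⟨n, ?_⟩
          rw [hk] at hn ⊢
          have : k < 1 := by exact_mod_cast hn
          have : k = 0 := by omega
          simp [this]
        have hρ0 : ρ univ = 0 := by
          refine measure_mono_null (t := ⋃ p : (Σ n : ℕ, {σ : Fin n → Bool // ρ (cell S n σ) = 0}),
            cell S p.1 p.2.1) (fun x _ => ?_) (measure_iUnion_null fun p => p.2.2)
          obtain ⟨n, hn⟩ := hzero x
          exact mem_iUnion.2 ⟨⟨n, ⟨_, hn⟩⟩, mem_cellAt n x⟩
        simpa [hρ] using hρ0
      rw [← inter_univ Aᶜ, ← hcov, inter_iUnion]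
      exact measure_iUnion_null hm
    ext B hB
    rw [Measure.sum_apply _ hB, ← measure_inter_add_sdiff B hAm,
      measure_mono_null (sdiff_subset_compl B A) hdiff, add_zero]
    have hBA : B ∩ A = ⋃ a ∈ A, {a} ∩ B := by
      ext x; simp [and_comm]
    rw [hBA, measure_biUnion hAc]
    · refine tsum_congr fun a => ?_
      rw [Measure.dirac_apply' _ hB]
      by_cases ha : (a : S) ∈ B
      · rw [inter_eq_left.2 (singleton_subset_iff.2 ha), hA1 a a.2, indicator_of_mem ha]
        rfl
      · rw [singleton_inter_eq_empty.2 ha, measure_empty, indicator_of_notMem ha]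
    · intro a _ b _ hab
      exact (disjoint_singleton.2 hab).mono inter_subset_left inter_subset_left
    · exact fun a _ => (measurableSet_singleton a).inter hB
  · obtain ⟨m, hm⟩ := hEK C hC
    exact (measure_mono hm).trans_lt (hfin m)

end Counting

/-! ### Poisson counts -/

section PoissonCounts

variable {Ω : Type*} [MeasurableSpace Ω] {Q : Measure Ω} {X : Ω → ℝ≥0∞} {r : ℝ≥0}

lemma ae_exists_nat_of_hasLaw_poisson
    (h : HasLaw X ((poissonMeasure r).map (fun k : ℕ => (k : ℝ≥0∞))) Q) :
    ∀ᵐ ω ∂Q, ∃ n : ℕ, X ω = n := by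
  have hm : MeasurableSet {x : ℝ≥0∞ | ∃ n : ℕ, x = n} := by
    have : {x : ℝ≥0∞ | ∃ n : ℕ, x = n} = range fun n : ℕ => (n : ℝ≥0∞) := by
      ext x; simp [eq_comm]
    rw [this]; exact (countable_range _).measurableSet
  refine (ae_map_iff h.aemeasurable hm).1 ?_
  rw [h.map_eq, ae_map_iff (measurable_of_countable _).aemeasurable hm]
  exact Eventually.of_forall fun k => ⟨k, rfl⟩

lemma measure_eq_zero_of_hasLaw_poisson
    (h : HasLaw X ((poissonMeasure r).map (fun k : ℕ => (k : ℝ≥0∞))) Q) :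
    Q {ω | X ω = 0} = ENNReal.ofReal (Real.exp (-r)) := by
  rw [h.measure_eq (p := fun x => x = 0) (measurableSet_singleton 0),
    Measure.map_apply (s := {x : ℝ≥0∞ | x = 0}) (measurable_of_countable _)
      (measurableSet_singleton 0)]
  have : (fun k : ℕ => (k : ℝ≥0∞)) ⁻¹' {x | x = 0} = {0} := by ext; simp
  rw [this, poissonMeasure_singleton]
  simp

/-- From `exp (-r) ≥ 1 - r` one gets `1 - (1 + r) exp (-r) ≤ r ^ 2`. The quadratic order is what
makes a union bound over ever finer cells tend to zero. -/
lemma measure_one_lt_le_of_hasLaw_poisson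
    (h : HasLaw X ((poissonMeasure r).map (fun k : ℕ => (k : ℝ≥0∞))) Q) :
    Q {ω | 1 < X ω} ≤ (r : ℝ≥0∞) ^ 2 := by
  rw [h.measure_eq (p := fun x => 1 < x) measurableSet_Ioi,
    Measure.map_apply (s := {x : ℝ≥0∞ | 1 < x}) (measurable_of_countable _) measurableSet_Ioi]
  have : (fun k : ℕ => (k : ℝ≥0∞)) ⁻¹' {x | 1 < x} = ((({0, 1} : Finset ℕ) : Set ℕ))ᶜ := by
    ext k
    simp only [mem_preimage, mem_ofPred_eq, Finset.coe_insert, Finset.coe_singleton, mem_compl_iff,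
      mem_insert_iff, mem_singleton_iff]
    rw [Nat.one_lt_cast]
    omega
  rw [this, ← ofReal_measureReal, measureReal_compl (Finset.measurableSet _),
    ← sum_measureReal_singleton, Finset.sum_pair zero_ne_one, poissonMeasure_real_singleton,
    poissonMeasure_real_singleton, ← ENNReal.coe_pow, ← ENNReal.ofReal_coe_nnreal]
  refine ENNReal.ofReal_le_ofReal ?_
  have h1 : 1 - (r : ℝ) ≤ Real.exp (-r) := by
    have := Real.add_one_le_exp (-(r : ℝ)); linarith
  have h0 : (0 : ℝ) ≤ r := r.2
  simp only [probReal_univ, pow_zero, Nat.factorial, pow_one]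
  push_cast
  nlinarith

end PoissonCounts

/-! ### Simplicity of processes with Poisson counts -/

section Simple

variable {T : Type*} [MeasurableSpace T] [CountablyGenerated T]

/-- Measures which are finite and integer valued on each `E m`, with mass at most one on all cells
of some level. They are simple counting measures if `E` is an exhaustion. -/
def simpleHull (E : ℕ → Set T) : Set (Measure T) :=
  ⋂ m, ({ν | ν (E m) < ∞} ∩
    (⋂ B ∈ generateSetAlgebra (countableGeneratingSet T), {ν | ∃ n : ℕ, ν (B ∩ E m) = n}) ∩
    ⋃ n, ⋂ σ, {ν | ν (cell T n σ ∩ E m) ≤ 1})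

lemma measurableSet_of_mem_generateSetAlgebra {B : Set T}
    (hB : B ∈ generateSetAlgebra (countableGeneratingSet T)) : MeasurableSet B := by
  have := measurableSet_generateFrom (s := generateSetAlgebra (countableGeneratingSet T)) hB
  rwa [generateFrom_generateSetAlgebra_eq, generateFrom_countableGeneratingSet] at this

/-- The hull imposes only countably many conditions, so that each can be checked almost surely.
Integrality extends from the countable algebra to all Borel sets by a π-λ argument, and an atom is
no heavier than the cell that contains it. -/
lemma isSimpleCounting_of_mem_simpleHull [TopologicalSpace T] [MeasurableSingletonClass T] {E : ℕ → Set T}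
    (hEK : ∀ C : Set T, IsCompact C → ∃ m, C ⊆ E m) {ν : Measure T} (hν : ν ∈ simpleHull E) : IsSimpleCounting ν := by
  simp only [simpleHull, mem_iInter, mem_inter_iff, mem_ofPred_eq, mem_iUnion] at hν
  refine isSimpleCounting_of_exhaustion hEK (fun m => (hν m).1.1) (fun m B hB => ?_) fun x => ?_
  · have : IsFiniteMeasure (ν.restrict (E m)) := ⟨by simpa using (hν m).1.1⟩
    have halg := isSetAlgebra_generateSetAlgebra (𝒜 := countableGeneratingSet T)
    have hgen : ‹MeasurableSpace T› =
        generateFrom (generateSetAlgebra (countableGeneratingSet T)) := by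
      rw [generateFrom_generateSetAlgebra_eq, generateFrom_countableGeneratingSet]
    have key : ∀ B ∈ generateSetAlgebra (countableGeneratingSet T),
        ∃ n : ℕ, ν.restrict (E m) B = n := fun B hB => by
      rw [Measure.restrict_apply (measurableSet_of_mem_generateSetAlgebra hB)]
      exact (hν m).1.2 B hB
    have := exists_nat_eq_of_isPiSystem (ν := ν.restrict (E m)) hgen
      (fun s hs t ht _ => halg.inter_mem hs ht) (key _ halg.univ_mem) key hB
    rwa [Measure.restrict_apply hB] at this
  · obtain ⟨m, hm⟩ := hEK {x} isCompact_singleton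
    obtain ⟨n, hn⟩ := (hν m).2
    refine (measure_mono ?_).trans (hn fun i => mapNatBool T x i)
    exact subset_inter (singleton_subset_iff.2 (mem_cellAt n x)) hm

/-- Two points in one cell of level `n` occur somewhere with probability at most the sum of the
squared cell intensities, which vanishes in the limit for an atomless measure. Only the
one-dimensional counts enter, not independence. -/
lemma ae_mem_simpleHull [MeasurableSingletonClass T] {lam : Measure T} {Q : Measure (Measure T)}
    {E : ℕ → Set T} (hE : ∀ m, MeasurableSet (E m)) (hfin : ∀ m, lam (E m) < ∞)
    (hat : ∀ x, lam {x} = 0)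
    (hcounts : ∀ B : Set T, MeasurableSet B → lam B < ∞ →
      HasLaw (fun ν : Measure T => ν B)
        ((poissonMeasure (lam B).toNNReal).map (fun k : ℕ => (k : ℝ≥0∞))) Q) :
    ∀ᵐ ν ∂Q, ν ∈ simpleHull E := by
  simp only [simpleHull, mem_iInter, mem_inter_iff, mem_ofPred_eq, mem_iUnion]
  refine ae_all_iff.2 fun m => ?_
  refine Eventually.and (Eventually.and ?_ ?_) ?_
  · filter_upwards [ae_exists_nat_of_hasLaw_poisson (hcounts _ (hE m) (hfin m))] with ν hν
    obtain ⟨n, hn⟩ := hν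
    simp [hn]
  · refine (ae_ball_iff (countable_generateSetAlgebra countable_countableGeneratingSet)).2
      fun B hB => ?_
    exact ae_exists_nat_of_hasLaw_poisson (hcounts _
      ((measurableSet_of_mem_generateSetAlgebra hB).inter (hE m))
      ((measure_mono inter_subset_right).trans_lt (hfin m)))
  · have : IsFiniteMeasure (lam.restrict (E m)) := ⟨by simpa using hfin m⟩
    have hat' : ∀ x, lam.restrict (E m) {x} = 0 := fun x =>
      le_antisymm ((Measure.restrict_apply_le _ _).trans_eq (hat x)) zero_le
    have hlim := tendsto_sum_sq_measure_cell (lam.restrict (E m)) hat'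
    have hle : ∀ n, Q {ν | ¬ ∃ n, ∀ σ, ν (cell T n σ ∩ E m) ≤ 1}
        ≤ ∑ σ : Fin n → Bool, lam.restrict (E m) (cell T n σ) ^ 2 := by
      intro n
      calc Q {ν | ¬ ∃ n, ∀ σ, ν (cell T n σ ∩ E m) ≤ 1}
          ≤ Q (⋃ σ, {ν | 1 < ν (cell T n σ ∩ E m)}) := by
            refine measure_mono fun ν hν => ?_
            simp only [mem_ofPred_eq, not_exists, not_forall, not_le] at hν
            exact mem_iUnion.2 (hν n)
        _ ≤ ∑ σ, Q {ν | 1 < ν (cell T n σ ∩ E m)} := measure_iUnion_fintype_le _ _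
        _ ≤ _ := by
            refine Finset.sum_le_sum fun σ _ => ?_
            have hlt : lam (cell T n σ ∩ E m) < ∞ :=
              (measure_mono inter_subset_right).trans_lt (hfin m)
            refine (measure_one_lt_le_of_hasLaw_poisson (hcounts _
              ((measurableSet_cell n σ).inter (hE m)) hlt)).trans_eq ?_
            rw [ENNReal.coe_toNNReal hlt.ne, Measure.restrict_apply (measurableSet_cell n σ)]
    exact le_antisymm (ge_of_tendsto' hlim hle) zero_le

end Simple

/-! ### Thinning and mapping of Poisson processes -/

section Thinning

variable {S T : Type*} [MeasurableSpace S] [MeasurableSpace T]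

lemma measurable_map_restrict {A : Set S} (hA : MeasurableSet A) {p : S → T} (hp : Measurable p) :
    Measurable fun ν : Measure S => (ν.restrict A).map p :=
  Measure.measurable_of_measurable_coe _ fun B hB => by
    simp_rw [Measure.map_apply hp hB, Measure.restrict_apply (hp hB)]
    exact Measure.measurable_coe ((hp hB).inter hA)

lemma map_restrict_apply {A : Set S} {p : S → T} (hp : Measurable p) (ν : Measure S) {B : Set T}
    (hB : MeasurableSet B) : (ν.restrict A).map p B = ν (p ⁻¹' B ∩ A) := by
  rw [Measure.map_apply hp hB, Measure.restrict_apply (hp hB)]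

/-- Restricting a Poisson process to a set and mapping its points gives a Poisson process, provided
that the image of the directing measure has no atoms and is locally finite. -/
theorem IsPoissonLaw.map_restrict [TopologicalSpace S] [TopologicalSpace T] [CountablyGenerated T] [MeasurableSingletonClass T]
    {lam : Measure S} {Q : Measure (Measure S)}
    (h : IsPoissonLaw lam Q) {A : Set S} (hA : MeasurableSet A) {p : S → T} (hp : Measurable p)
    {E : ℕ → Set T} (hE : ∀ m, MeasurableSet (E m))
    (hEK : ∀ C : Set T, IsCompact C → ∃ m, C ⊆ E m)
    (hfin : ∀ m, (lam.restrict A).map p (E m) < ∞) (hat : ∀ x, (lam.restrict A).map p {x} = 0) :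
    IsPoissonLaw ((lam.restrict A).map p) (Q.map fun ν => (ν.restrict A).map p) := by
  have hφ := measurable_map_restrict hA hp
  have hQ := h.isProbabilityMeasure
  have hcounts : ∀ B : Set T, MeasurableSet B → (lam.restrict A).map p B < ∞ →
      HasLaw (fun ν : Measure T => ν B)
        ((poissonMeasure ((lam.restrict A).map p B).toNNReal).map (fun k : ℕ => (k : ℝ≥0∞)))
        (Q.map fun ν => (ν.restrict A).map p) := by
    intro B hB hlt
    rw [map_restrict_apply hp _ hB] at hlt ⊢
    have h1 := h.counts _ ((hp hB).inter hA) hlt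
    refine ⟨(Measure.measurable_coe hB).aemeasurable, ?_⟩
    rw [Measure.map_map (Measure.measurable_coe hB) hφ, ← h1.map_eq]
    congr 1
    ext1 ν
    exact map_restrict_apply hp ν hB
  have hQ' := Measure.isProbabilityMeasure_map hφ.aemeasurable (μ := Q)
  refine ⟨⟨fun C hC => ?_⟩, Measure.isProbabilityMeasure_map hφ.aemeasurable, ?_, hcounts, ?_⟩
  · obtain ⟨m, hm⟩ := hEK C hC
    exact (measure_mono hm).trans_lt (hfin m)
  · filter_upwards [ae_mem_simpleHull hE hfin hat hcounts] with ν hν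
    exact isSimpleCounting_of_mem_simpleHull hEK hν
  · intro n B hB hd
    have h1 := h.indep n (fun i => p ⁻¹' B i ∩ A) (fun i => (hp (hB i)).inter hA)
      fun i j hij => ((hd hij).preimage p).mono inter_subset_left inter_subset_left
    rw [iIndepFun_iff_map_fun_eq_pi_map
      (fun i => (Measure.measurable_coe ((hp (hB i)).inter hA)).aemeasurable)] at h1
    rw [iIndepFun_iff_map_fun_eq_pi_map fun i => (Measure.measurable_coe (hB i)).aemeasurable]
    rw [Measure.map_map (measurable_pi_lambda _ fun i => Measure.measurable_coe (hB i)) hφ]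
    have h2 : ((fun ν : Measure T => fun i => ν (B i)) ∘ fun ν : Measure S => (ν.restrict A).map p)
        = fun ν i => ν (p ⁻¹' B i ∩ A) := by
      ext ν i
      exact map_restrict_apply hp ν (hB i)
    rw [h2, h1]
    congr 1
    ext1 i
    rw [Measure.map_map (Measure.measurable_coe (hB i)) hφ]
    congr 1
    ext1 ν
    exact (map_restrict_apply hp ν (hB i)).symm

end Thinning

/-! ### Uniqueness of Poisson laws -/

section Unique

variable {T : Type*} [TopologicalSpace T] [MeasurableSpace T] {lam : Measure T}
  {Q Q' : Measure (Measure T)}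

/-- The points which lie in exactly those sets of the family `B` whose index is in `σ`. -/
def exactly {ι : Type*} (B : ι → Set T) (σ : Finset ι) : Set T := {x | ∀ i, x ∈ B i ↔ i ∈ σ}

omit [TopologicalSpace T] in
lemma measurableSet_exactly {ι : Type*} [Finite ι] {B : ι → Set T}
    (hB : ∀ i, MeasurableSet (B i)) (σ : Finset ι) : MeasurableSet (exactly B σ) := by
  have : exactly B σ = ⋂ i, {x | x ∈ B i ↔ i ∈ σ} := by ext; simp [exactly]
  rw [this]
  exact MeasurableSet.iInter fun i => (hB i).iff (MeasurableSet.const _)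

-- Overlapping sets are cut into the disjoint atoms of the algebra they generate, so that
-- independence over disjoint sets also governs counts of overlapping ones.
omit [TopologicalSpace T] in
open scoped Classical in
lemma measure_eq_sum_exactly {ι : Type*} [Fintype ι] {B : ι → Set T}
    (hB : ∀ i, MeasurableSet (B i)) (ν : Measure T) (i : ι) :
    ν (B i) = ∑ σ : {σ : Finset ι // σ.Nonempty},
      if i ∈ σ.1 then ν (exactly B σ.1) else 0 := by
  rw [← Finset.sum_filter, ← measure_biUnion_finset]
  · congr 1
    ext x
    simp only [Finset.mem_filter, Finset.mem_univ, true_and, mem_iUnion, exactly, mem_ofPred_eq,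
      exists_prop]
    constructor
    · intro hx
      refine ⟨⟨Finset.univ.filter fun j => x ∈ B j, ⟨i, by simpa using hx⟩⟩, by simpa using hx, ?_⟩
      simp
    · rintro ⟨σ, hi, h⟩
      exact (h i).2 hi
  · intro σ _ τ _ hne
    refine disjoint_left.2 fun x hx hy => hne ?_
    ext i
    rw [← hx i, ← hy i]
  · exact fun σ _ => measurableSet_exactly hB _

/-- Both joint laws are the product of the same Poisson marginals. The detour through `Fin` is
needed because independence is postulated for families indexed by `Fin n`. -/
lemma IsPoissonLaw.map_pi_eq (h : IsPoissonLaw lam Q) (h' : IsPoissonLaw lam Q') {ι : Type*}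
    [Fintype ι] {B : ι → Set T} (hB : ∀ i, MeasurableSet (B i))
    (hd : Pairwise fun i j => Disjoint (B i) (B j)) (hfin : ∀ i, lam (B i) < ∞) :
    Q.map (fun ν i => ν (B i)) = Q'.map fun ν i => ν (B i) := by
  have key : ∀ {R : Measure (Measure T)}, IsPoissonLaw lam R →
      R.map (fun ν (k : Fin (Fintype.card ι)) => ν (B ((Fintype.equivFin ι).symm k)))
        = Measure.pi fun k => (poissonMeasure (lam (B ((Fintype.equivFin ι).symm k))).toNNReal).map
            (fun k : ℕ => (k : ℝ≥0∞)) := by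
    intro R hR
    have := hR.isProbabilityMeasure
    rw [(iIndepFun_iff_map_fun_eq_pi_map fun k =>
      (Measure.measurable_coe (hB ((Fintype.equivFin ι).symm k))).aemeasurable).1
      (hR.indep _ (fun k => B ((Fintype.equivFin ι).symm k)) (fun k => hB _)
        fun i j hij => hd fun hij' => hij ((Fintype.equivFin ι).symm.injective hij'))]
    congr 1
    ext1 k
    exact (hR.counts _ (hB _) (hfin _)).map_eq
  have hre : ∀ R : Measure (Measure T), R.map (fun ν i => ν (B i)) =
      (R.map (fun ν (k : Fin (Fintype.card ι)) => ν (B ((Fintype.equivFin ι).symm k)))).map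
        fun x i => x (Fintype.equivFin ι i) := by
    intro R
    rw [Measure.map_map (by fun_prop)
      (measurable_pi_lambda _ fun k => Measure.measurable_coe (hB _))]
    congr 1
    ext ν i
    simp
  rw [hre Q, hre Q', key h, key h']

open scoped Classical in
/-- A Poisson law is determined by its directing measure. -/
theorem IsPoissonLaw.unique (h : IsPoissonLaw lam Q) (h' : IsPoissonLaw lam Q') {E : ℕ → Set T}
    (hE : ∀ m, MeasurableSet (E m)) (hmono : Monotone E) (hcov : ⋃ m, E m = univ)
    (hfin : ∀ m, lam (E m) < ∞) : Q = Q' := by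
  have hQ := h.isProbabilityMeasure
  let I := {B : Set T // MeasurableSet B ∧ lam B < ∞}
  let ev : Measure T → I → ℝ≥0∞ := fun ν B => ν B.1
  have hev : Measurable ev := measurable_pi_lambda _ fun B => Measure.measurable_coe B.2.1
  -- A law on a product is determined by its finite-dimensional marginals, and these are images of
  -- the joint law of the counts in disjoint atoms.
  have hmap : Q.map ev = Q'.map ev := by
    refine IsProjectiveLimit.unique (P := fun J : Finset I => (Q.map ev).map J.restrict)
      (fun J => rfl) fun J => ?_
    have hsplit : ∀ R : Measure (Measure T), (R.map ev).map J.restrict =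
        (R.map fun ν (σ : {σ : Finset J // σ.Nonempty}) =>
          ν (exactly (fun i : J => i.1.1) σ.1)).map
          fun x i => ∑ σ : {σ : Finset J // σ.Nonempty}, if i ∈ σ.1 then x σ else 0 := by
      intro R
      rw [Measure.map_map (by fun_prop) hev, Measure.map_map]
      · congr 1
        ext ν i
        refine (measure_eq_sum_exactly (fun i : J => i.1.2.1) ν i).trans ?_
        simp only [Function.comp]
        congr!
      · refine measurable_pi_lambda _ fun i => Finset.measurable_fun_sum _ fun σ _ => ?_
        split_ifs <;> fun_prop
      · exact measurable_pi_lambda _ fun σ =>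
          Measure.measurable_coe (measurableSet_exactly (fun i : J => i.1.2.1) _)
    refine (hsplit Q').trans (Eq.trans ?_ (hsplit Q).symm)
    congr 1
    refine (h.map_pi_eq h' (fun σ => measurableSet_exactly (fun i : J => i.1.2.1) _)
      (fun σ τ hne => ?_) fun σ => ?_).symm
    · refine disjoint_left.2 fun x hx hy => hne ?_
      ext i
      rw [← hx i, ← hy i]
    -- Nonemptiness of the index set places the atom inside some set of finite mass; the omitted
    -- atom, outside all the sets, may have infinite mass.
    · obtain ⟨i, hi⟩ := σ.2
      exact (measure_mono fun x hx => (hx i).2 hi).trans_lt i.1.2.2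
  -- Evaluations at sets of infinite intensity are also part of the `σ`-algebra; they are suprema of
  -- evaluations along the exhaustion.
  have hle : (inferInstance : MeasurableSpace (Measure T)) ≤ MeasurableSpace.comap ev inferInstance := by
    refine iSup₂_le fun B hB => ?_
    rw [← measurable_iff_comap_le]
    have heq : (fun ν : Measure T => ν B) = fun ν => ⨆ m, ν (B ∩ E m) := by
      ext ν
      rw [← Monotone.measure_iUnion fun i j hij => inter_subset_inter_right B (hmono hij),
        ← inter_iUnion, hcov, inter_univ]
    rw [heq]
    refine Measurable.iSup fun m => ?_
    have hm : lam (B ∩ E m) < ∞ := (measure_mono inter_subset_right).trans_lt (hfin m)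
    exact (measurable_pi_apply (⟨B ∩ E m, hB.inter (hE m), hm⟩ : I)).comp
      (comap_measurable ev)
  ext s hs
  obtain ⟨t, ht, rfl⟩ := hle s hs
  rw [← Measure.map_apply hev ht, hmap, Measure.map_apply hev ht]

end Unique

/-! ### Joint measurability of thinnings -/

section Cut

variable {S T Z : Type*} [MeasurableSpace S] [MeasurableSpace T] [MeasurableSpace Z]
  {D : ℕ → Set S}

open scoped Classical in
/-- The kernel which restricts a measure to `D n` if this leaves a mass in `[k, k + 1)`. -/
def cutPiece (hD : ∀ n, MeasurableSet (D n)) (n k : ℕ) : Kernel (Measure S) S where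
  toFun ν := if (k : ℝ≥0∞) ≤ ν (D n) ∧ ν (D n) < k + 1 then ν.restrict (D n) else 0
  measurable' := by
    refine Measurable.ite ?_ ?_ measurable_const
    · exact (Measure.measurable_coe (hD n) measurableSet_Ici).inter
        (Measure.measurable_coe (hD n) measurableSet_Iio)
    · refine Measure.measurable_of_measurable_coe _ fun B hB => ?_
      simp_rw [Measure.restrict_apply hB]
      exact Measure.measurable_coe (hB.inter (hD n))

instance (hD : ∀ n, MeasurableSet (D n)) (n k : ℕ) : IsFiniteKernel (cutPiece hD n k) := by
  refine ⟨⟨k + 1, by finiteness, fun ν => ?_⟩⟩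
  change (if _ then ν.restrict (D n) else 0 : Measure S) univ ≤ _
  split_ifs with h
  · simpa using h.2.le
  · simp

/-- The identity kernel on the measures which are finite on all sets `D n`. -/
def cut (hD : ∀ n, MeasurableSet (D n)) : Kernel (Measure S) S :=
  Kernel.sum fun q : ℕ × ℕ => cutPiece hD q.1 q.2

instance (hD : ∀ n, MeasurableSet (D n)) : IsSFiniteKernel (cut hD) :=
  Kernel.isSFiniteKernel_sum (hκs := fun _ => inferInstance)

/-- For each `n` exactly one `k` survives, the integer part of `ν (D n)`, so the double sum
reassembles `ν` from its restrictions to the partition. -/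
lemma cut_apply (hD : ∀ n, MeasurableSet (D n)) (hdisj : Pairwise (Function.onFun Disjoint D))
    (hcov : ⋃ n, D n = univ) {ν : Measure S} (hν : ∀ n, ν (D n) < ∞) : cut hD ν = ν := by
  ext B hB
  rw [cut, Kernel.sum_apply' _ _ hB, ENNReal.tsum_prod (f := fun n k => cutPiece hD n k ν B)]
  have hin : ∀ n, ∑' k, cutPiece hD n k ν B = ν (B ∩ D n) := by
    intro n
    have hfl : ∀ k : ℕ, ((k : ℝ≥0∞) ≤ ν (D n) ∧ ν (D n) < k + 1) ↔
        k = ⌊(ν (D n)).toNNReal⌋₊ := by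
      intro k
      rw [eq_comm, Nat.floor_eq_iff zero_le, ← ENNReal.coe_le_coe, ← ENNReal.coe_lt_coe,
        ENNReal.coe_toNNReal (hν n).ne]
      simp
    rw [tsum_eq_single ⌊(ν (D n)).toNNReal⌋₊]
    · change (if _ then ν.restrict (D n) else 0 : Measure S) B = _
      rw [if_pos ((hfl _).2 rfl), Measure.restrict_apply hB]
    · intro k hk
      change (if _ then ν.restrict (D n) else 0 : Measure S) B = _
      rw [if_neg fun h => hk ((hfl k).1 h)]
      rfl
  simp_rw [hin]
  rw [← measure_iUnion (fun i j hij => (hdisj hij).mono inter_subset_right inter_subset_right)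
    fun n => hB.inter (hD n), ← inter_iUnion, hcov, inter_univ]

/-- Restriction of a measure to the section of `A` at `z`, followed by `p`. -/
def thin (hD : ∀ n, MeasurableSet (D n)) (A : Set (Z × S)) (p : S → T) (z : Z × Measure S) :
    Measure T :=
  ((cut hD z.2).restrict (Prod.mk z.1 ⁻¹' A)).map p

/-- Measurability of the mass of a section that varies with the parameter is available for s-finite
kernels. This is why `thin` goes through `cut` instead of using the measure itself. -/
lemma measurable_thin (hD : ∀ n, MeasurableSet (D n)) {A : Set (Z × S)} (hA : MeasurableSet A)
    {p : S → T} (hp : Measurable p) : Measurable (thin hD A p) := by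
  refine Measure.measurable_of_measurable_coe _ fun B hB => ?_
  let κ' : Kernel (Z × Measure S) S := (cut hD).comap Prod.snd measurable_snd
  have heq : (fun z => thin hD A p z B) = fun z : Z × Measure S =>
      κ' z
        (Prod.mk z ⁻¹' {y : (Z × Measure S) × S | (y.1.1, y.2) ∈ A ∧ p y.2 ∈ B}) := by
    ext z
    rw [thin, map_restrict_apply hp _ hB, Kernel.comap_apply]
    congr 1
    ext s
    simp [and_comm]
  rw [heq]
  refine Kernel.measurable_kernel_prodMk_left (MeasurableSet.inter ?_ ?_)
  · exact (by fun_prop : Measurable fun y : (Z × Measure S) × S => (y.1.1, y.2)) hA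
  · exact (hp.comp measurable_snd) hB

/-- The kernel of the laws of the thinned processes. -/
def thinKernel (hD : ∀ n, MeasurableSet (D n)) (A : Set (Z × S)) (p : S → T)
    (κ : Kernel Z (Measure S)) : Kernel Z (Measure T) :=
  (Kernel.id ×ₖ κ).map (thin hD A p)

lemma thinKernel_apply (hD : ∀ n, MeasurableSet (D n)) {A : Set (Z × S)} (hA : MeasurableSet A)
    {p : S → T} (hp : Measurable p) (κ : Kernel Z (Measure S)) [IsMarkovKernel κ] (z : Z) :
    thinKernel hD A p κ z = (κ z).map fun ν => thin hD A p (z, ν) := by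
  rw [thinKernel, Kernel.map_apply _ (measurable_thin hD hA hp), Kernel.prod_apply, Kernel.id_apply,
    Measure.dirac_prod, Measure.map_map (measurable_thin hD hA hp) measurable_prodMk_left]
  rfl

lemma isMarkovKernel_thinKernel (hD : ∀ n, MeasurableSet (D n)) {A : Set (Z × S)}
    (hA : MeasurableSet A) {p : S → T} (hp : Measurable p) (κ : Kernel Z (Measure S))
    [IsMarkovKernel κ] : IsMarkovKernel (thinKernel hD A p κ) :=
  Kernel.IsMarkovKernel.map _ (measurable_thin hD hA hp)

/-- A Poisson process is almost surely finite on every set of the partition, and there `cut` changes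
nothing. -/
lemma thinKernel_apply_eq_map_restrict [TopologicalSpace S] (hD : ∀ n, MeasurableSet (D n))
    (hdisj : Pairwise (Function.onFun Disjoint D)) (hcov : ⋃ n, D n = univ)
    {A : Set (Z × S)} (hA : MeasurableSet A)
    {p : S → T} (hp : Measurable p) (κ : Kernel Z (Measure S)) [IsMarkovKernel κ] {z : Z}
    {lam : Measure S} (h : IsPoissonLaw lam (κ z)) (hfin : ∀ n, lam (D n) < ∞) :
    thinKernel hD A p κ z = (κ z).map fun ν => (ν.restrict (Prod.mk z ⁻¹' A)).map p := by
  rw [thinKernel_apply hD hA hp]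
  refine Measure.map_congr ?_
  have : ∀ᵐ ν ∂(κ z), ∀ n, ν (D n) < ∞ := by
    refine ae_all_iff.2 fun n => ?_
    filter_upwards [ae_exists_nat_of_hasLaw_poisson (h.counts _ (hD n) (hfin n))] with ν hν
    obtain ⟨k, hk⟩ := hν
    simp [hk]
  filter_upwards [this] with ν hν
  rw [thin, cut_apply hD hdisj hcov hν]

end Cut

/-! ### The severity measure -/

lemma severityMeasure_apply {B : Set ℝ≥0∞} (hB : MeasurableSet B) :
    severityMeasure ((↑) ⁻¹' B) =
      ∫⁻ x in {x : ℝ | 0 < x ∧ ENNReal.ofReal x ∈ B}, ENNReal.ofReal ((x ^ 2)⁻¹) := by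
  rw [severityMeasure, (MeasurableEmbedding.subtype_coe measurableSet_Ioi).comap_apply,
    Subtype.image_preimage_coe, Measure.map_apply ENNReal.measurable_ofReal
      (measurableSet_Ioi.inter hB), withDensity_apply _
      (ENNReal.measurable_ofReal (measurableSet_Ioi.inter hB)),
    Measure.restrict_restrict (ENNReal.measurable_ofReal (measurableSet_Ioi.inter hB))]
  congr 2
  ext x
  simp only [mem_inter_iff, mem_preimage, mem_Ioi, ENNReal.ofReal_pos, mem_ofPred_eq]
  tauto

lemma lintegral_Ici_inv_sq {a : ℝ} (ha : 0 < a) :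
    ∫⁻ x in Ici a, ENNReal.ofReal ((x ^ 2)⁻¹) = ENNReal.ofReal a⁻¹ := by
  have heq : ∀ x ∈ Ioi a, (x ^ 2)⁻¹ = x ^ (-2 : ℝ) := fun x hx => by
    rw [Real.rpow_neg (ha.trans hx).le]; norm_cast
  rw [setLIntegral_congr Ioi_ae_eq_Ici.symm,
    setLIntegral_congr_fun measurableSet_Ioi fun x hx => congrArg ENNReal.ofReal (heq x hx),
    ← ofReal_integral_eq_lintegral_ofReal (integrableOn_Ioi_rpow_of_lt (by norm_num) ha)
      ((ae_restrict_mem measurableSet_Ioi).mono fun x hx => Real.rpow_nonneg (ha.trans hx).le _),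
    integral_Ioi_rpow_of_lt (by norm_num) ha]
  congr 1
  norm_num
  exact Real.rpow_neg_one a

/-- For `0 < h < ∞` the condition reads `u ≥ 1 / h`, and `u⁻²` integrates to `h` over that
half-line. For `h = 0` only `u = ∞` is left, which carries no mass; `h = ∞` follows by monotonicity.
-/
lemma severityMeasure_inv_le (h : ℝ≥0∞) :
    severityMeasure {u : Severity | (u : ℝ≥0∞)⁻¹ ≤ h} = h := by
  have hms : ∀ h : ℝ≥0∞, MeasurableSet {v : ℝ≥0∞ | v⁻¹ ≤ h} := fun h =>
    measurable_inv measurableSet_Iic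
  have hnn : ∀ r : ℝ≥0, severityMeasure {u : Severity | (u : ℝ≥0∞)⁻¹ ≤ r} = r := by
    intro r
    refine (severityMeasure_apply (hms r)).trans ?_
    rcases eq_or_ne r 0 with rfl | hr
    · have : {x : ℝ | 0 < x ∧ ENNReal.ofReal x ∈ {v : ℝ≥0∞ | v⁻¹ ≤ ((0 : ℝ≥0) : ℝ≥0∞)}} = ∅ := by
        ext x; simp
      rw [this]; simp
    · have hr' : (0 : ℝ) < r := NNReal.coe_pos.2 (pos_iff_ne_zero.2 hr)
      have : {x : ℝ | 0 < x ∧ ENNReal.ofReal x ∈ {v : ℝ≥0∞ | v⁻¹ ≤ (r : ℝ≥0∞)}}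
          = Ici (r : ℝ)⁻¹ := by
        ext x
        simp only [mem_ofPred_eq, mem_Ici]
        have hiff : 0 < x → ((ENNReal.ofReal x)⁻¹ ≤ (r : ℝ≥0∞) ↔ (r : ℝ)⁻¹ ≤ x) := by
          intro hx
          rw [← ENNReal.ofReal_inv_of_pos hx, ← ENNReal.ofReal_coe_nnreal,
            ENNReal.ofReal_le_ofReal_iff r.coe_nonneg, inv_le_comm₀ hx hr']
        constructor
        · rintro ⟨hx, h⟩
          exact (hiff hx).1 h
        · intro h
          have hx := (inv_pos.2 hr').trans_le h
          exact ⟨hx, (hiff hx).2 h⟩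
      rw [this, lintegral_Ici_inv_sq (inv_pos.2 hr'), inv_inv, ENNReal.ofReal_coe_nnreal]
  induction h with
  | coe r => exact hnn r
  | top =>
    refine ENNReal.eq_top_of_forall_nnreal_le fun r => ?_
    rw [← hnn r]
    exact measure_mono fun u _ => (le_top : (u : ℝ≥0∞)⁻¹ ≤ ∞)

instance : SigmaFinite severityMeasure := by
  refine ⟨⟨{ set := fun n => {u : Severity | (u : ℝ≥0∞)⁻¹ ≤ n}, set_mem := fun _ => trivial,
             finite := fun n => ?_, spanning := ?_ }⟩⟩
  · rw [severityMeasure_inv_le]; exact ENNReal.natCast_lt_top n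
  · refine eq_univ_of_forall fun u => ?_
    have hu : (u : ℝ≥0∞)⁻¹ ≠ ∞ := ENNReal.inv_ne_top.2 (ne_of_gt u.2)
    obtain ⟨n, hn⟩ := ENNReal.exists_nat_gt hu
    exact mem_iUnion.2 ⟨n, hn.le⟩

/-! ### The intensity of storms -/

section Storms

variable {d : ℕ}

/-- The storms whose inverse severity is at most `H` of centre and shape. -/
def belowLevel (H : Loc d × Path d → ℝ≥0∞) : Set (Storm d) :=
  {x | (x.2.1 : ℝ≥0∞)⁻¹ ≤ H (x.1, x.2.2)}

lemma measurableSet_belowLevel {H : Loc d × Path d → ℝ≥0∞} (hH : Measurable H) :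
    MeasurableSet (belowLevel H) :=
  measurableSet_le (by fun_prop) (by fun_prop)

lemma measurable_path (f : Path d) : Measurable f := f.continuous.measurable

lemma measurable_path_uncurry : Measurable fun q : Path d × Loc d => q.1 q.2 :=
  (ContinuousEval.continuous_eval : Continuous fun q : Path d × Loc d => q.1 q.2).measurable

variable (μ : ℝ≥0) (PX : Measure (Path d)) [IsProbabilityMeasure PX]

/-- Fubini with the severity integrated first: for fixed centre and shape the admissible severities
have mass `H (s, f)`. -/
lemma stormIntensity_apply (ψ : Path d) {H : Loc d × Path d → ℝ≥0∞} (hH : Measurable H)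
    {B : Set (Loc d)} (hB : MeasurableSet B) :
    stormIntensity μ PX ψ (Prod.fst ⁻¹' B ∩ belowLevel H) =
      ∫⁻ s in B, (μ : ℝ≥0∞)⁻¹ * (∫⁻ f, H (s, f) ∂PX) * ψ s := by
  have hA := (measurable_fst (α := Loc d) (β := Severity × Path d) hB).inter
    (measurableSet_belowLevel hH)
  have hψ : Measurable fun s : Loc d => (μ : ℝ≥0∞)⁻¹ * (ψ s : ℝ≥0∞) :=
    (measurable_path ψ).coe_nnreal_ennreal.const_mul _
  have hI : Measurable fun s => ∫⁻ f, H (s, f) ∂PX := hH.lintegral_prod_right'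
  have hsec : ∀ s, severityMeasure.prod PX (Prod.mk s ⁻¹' (Prod.fst ⁻¹' B ∩ belowLevel H))
      = B.indicator (fun s => ∫⁻ f, H (s, f) ∂PX) s := by
    intro s
    by_cases hs : s ∈ B
    · rw [indicator_of_mem hs, Measure.prod_apply_symm (measurable_prodMk_left hA)]
      refine lintegral_congr fun f => ?_
      rw [← severityMeasure_inv_le (H (s, f))]
      congr 1
      ext u
      simp [hs, belowLevel]
    · rw [indicator_of_notMem hs]
      convert measure_empty (μ := severityMeasure.prod PX)
      ext u
      simp [hs]
  rw [stormIntensity, Measure.prod_apply hA]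
  simp_rw [hsec]
  rw [lintegral_withDensity_eq_lintegral_mul _ hψ (hI.indicator hB), ← lintegral_indicator hB]
  refine lintegral_congr fun s => ?_
  by_cases hs : s ∈ B
  · simp only [Pi.mul_apply, indicator_of_mem hs]
    ring
  · simp [indicator_of_notMem hs]

lemma map_restrict_stormIntensity (ψ : Path d) {H : Loc d × Path d → ℝ≥0∞} (hH : Measurable H) :
    ((stormIntensity μ PX ψ).restrict (belowLevel H)).map Prod.fst =
      volume.withDensity fun s => (μ : ℝ≥0∞)⁻¹ * (∫⁻ f, H (s, f) ∂PX) * ψ s := by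
  ext B hB
  rw [map_restrict_apply measurable_fst _ hB, stormIntensity_apply μ PX ψ hH hB,
    withDensity_apply _ hB]

/-- Storms with centre in the ball of radius `n` and inverse severity at most `n`. -/
def stormBox (d n : ℕ) : Set (Storm d) :=
  Prod.fst ⁻¹' Metric.closedBall 0 n ∩ belowLevel fun _ => n

lemma measurableSet_stormBox (n : ℕ) : MeasurableSet (stormBox d n) :=
  (measurable_fst Metric.isClosed_closedBall.measurableSet).inter
    (measurableSet_belowLevel measurable_const)

lemma iUnion_stormBox : ⋃ n, stormBox d n = univ := by
  refine eq_univ_of_forall fun x => ?_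
  have hu : (x.2.1 : ℝ≥0∞)⁻¹ ≠ ∞ := ENNReal.inv_ne_top.2 (ne_of_gt x.2.1.2)
  obtain ⟨n, hn⟩ := ENNReal.exists_nat_gt hu
  obtain ⟨m, hm⟩ := exists_nat_ge ‖x.1‖
  refine mem_iUnion.2 ⟨max n m, ?_, ?_⟩
  · simp only [mem_preimage, mem_closedBall_zero_iff]
    exact hm.trans (by exact_mod_cast le_max_right n m)
  · exact hn.le.trans (Nat.cast_le.2 (le_max_left n m))

lemma exists_bound_path (ψ : Path d) {B : Set (Loc d)} (hB : IsCompact B) :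
    ∃ M : ℝ≥0, ∀ s ∈ B, ψ s ≤ M := by
  obtain ⟨M, hM⟩ := (hB.image ψ.continuous).bddAbove
  exact ⟨M, fun s hs => hM (mem_image_of_mem _ hs)⟩

lemma stormIntensity_stormBox_lt_top (hμ : 0 < μ) (ψ : Path d) (n : ℕ) :
    stormIntensity μ PX ψ (stormBox d n) < ∞ := by
  have hcomp : IsCompact (Metric.closedBall (0 : Loc d) n) := isCompact_closedBall _ _
  obtain ⟨M, hM⟩ := exists_bound_path ψ hcomp
  rw [stormBox, stormIntensity_apply μ PX ψ measurable_const hcomp.measurableSet]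
  calc ∫⁻ s in Metric.closedBall 0 n, (μ : ℝ≥0∞)⁻¹ * (∫⁻ _, (n : ℝ≥0∞) ∂PX) * ψ s
      ≤ ∫⁻ s in Metric.closedBall (0 : Loc d) n, (μ : ℝ≥0∞)⁻¹ * n * M := by
        refine setLIntegral_mono' hcomp.measurableSet fun s hs => ?_
        have := hM s hs
        simp only [lintegral_const, measure_univ, mul_one]
        gcongr
    _ < ∞ := by
        rw [setLIntegral_const]
        have hμ' : (μ : ℝ≥0∞)⁻¹ ≠ ∞ := ENNReal.inv_ne_top.2 (by exact_mod_cast hμ.ne')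
        exact ENNReal.mul_lt_top (by finiteness) hcomp.measure_lt_top

/-- A partition of the space of storms into sets of finite intensity. -/
def stormCell (d : ℕ) : ℕ → Set (Storm d) := disjointed (stormBox d)

lemma measurableSet_stormCell (n : ℕ) : MeasurableSet (stormCell d n) :=
  MeasurableSet.disjointed measurableSet_stormBox n

lemma pairwise_disjoint_stormCell : Pairwise (Function.onFun Disjoint (stormCell d)) :=
  disjoint_disjointed _

lemma iUnion_stormCell : ⋃ n, stormCell d n = univ := by
  rw [stormCell, iUnion_disjointed, iUnion_stormBox]

lemma stormIntensity_stormCell_lt_top (hμ : 0 < μ) (ψ : Path d) (n : ℕ) :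
    stormIntensity μ PX ψ (stormCell d n) < ∞ :=
  (measure_mono (disjointed_subset _ n)).trans_lt (stormIntensity_stormBox_lt_top μ PX hμ ψ n)

/-! ### The correcting factor -/

/-- With `a / 0 = ∞` for `a > 0` and `0 / 0 = 0`, the set where `a / b > c` is the open set `c * b <
a`, including where `b = 0`. -/
lemma lowerSemicontinuous_ennreal_div :
    LowerSemicontinuous fun q : ℝ≥0 × ℝ≥0 => (q.1 : ℝ≥0∞) / q.2 := by
  rw [lowerSemicontinuous_iff_isOpen_preimage]
  intro c
  induction c with
  | top => simp
  | coe c =>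
    have : (fun q : ℝ≥0 × ℝ≥0 => (q.1 : ℝ≥0∞) / q.2) ⁻¹' Ioi (c : ℝ≥0∞)
        = {q | c * q.2 < q.1} := by
      ext ⟨a, b⟩
      simp only [mem_preimage, mem_Ioi, mem_ofPred_eq]
      rw [ENNReal.lt_div_iff_mul_lt (Or.inr (by simp)) (Or.inl (by simp))]
      norm_cast
    rw [this]
    exact isOpen_lt (by fun_prop) (by fun_prop)

/-- The supremum is uncountable, so measurability comes from topology: lower semicontinuity survives
arbitrary suprema. -/
lemma measurable_supRatio (K : Set (Loc d)) :
    Measurable fun q : Path d × (Loc d × Path d) => supRatio K q.1 q.2.2 q.2.1 := by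
  refine LowerSemicontinuous.measurable ?_
  unfold supRatio
  refine lowerSemicontinuous_iSup fun t => lowerSemicontinuous_iSup fun _ => ?_
  have hc : Continuous fun q : Path d × (Loc d × Path d) => (q.2.2 (t - q.2.1), q.1 t) := by
    fun_prop
  exact lowerSemicontinuous_ennreal_div.comp hc

end Storms

section Storms

variable {d : ℕ} (μ : ℝ≥0) (PX : Measure (Path d)) [IsProbabilityMeasure PX]

lemma measurable_supRatio_comp {α : Type*} [MeasurableSpace α] {y f : α → Path d} {s : α → Loc d}
    (hy : Measurable y) (hf : Measurable f) (hs : Measurable s) (K : Set (Loc d)) :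
    Measurable fun a => supRatio K (y a) (f a) (s a) := by
  have h : Measurable fun a => (y a, s a, f a) := hy.prodMk (hs.prodMk hf)
  have := (measurable_supRatio K).comp h
  exact this

/-- The storms which contribute on `K` to a field `y`, jointly in `y` and the storm. -/
def contributing (K : Set (Loc d)) : Set ((Path d × Path d) × Storm d) :=
  {x | x.2 ∈ belowLevel fun q => supRatio K x.1.2 q.2 q.1}

lemma measurableSet_contributing (K : Set (Loc d)) : MeasurableSet (contributing K) := by
  refine measurableSet_le (f := fun x : (Path d × Path d) × Storm d => (x.2.2.1 : ℝ≥0∞)⁻¹)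
    (by fun_prop) ?_
  exact measurable_supRatio_comp (by fun_prop) (by fun_prop) (by fun_prop) K

lemma measurable_correctingFactor (K : Set (Loc d)) :
    Measurable fun q : Path d × Loc d => correctingFactor μ PX K q.1 q.2 := by
  unfold correctingFactor
  refine Measurable.const_mul ?_ _
  refine Measurable.lintegral_prod_right' (f := fun q : (Path d × Loc d) × Path d =>
    supRatio K q.1.1 q.2 q.1.2) ?_
  exact measurable_supRatio_comp (by fun_prop) (by fun_prop) (by fun_prop) K

lemma measurable_centreIntensity (K : Set (Loc d)) :
    Measurable fun z : Path d × Path d => centreIntensity μ PX K z.1 z.2 := by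
  refine Measure.measurable_of_measurable_coe _ fun B hB => ?_
  simp_rw [centreIntensity, withDensity_apply _ hB]
  refine Measurable.lintegral_prod_right' (f := fun q : (Path d × Path d) × Loc d =>
    correctingFactor μ PX K q.1.2 q.2 * (q.1.1 q.2 : ℝ≥0∞)) ?_
  refine Measurable.mul ?_ ?_
  · have h : Measurable fun q : (Path d × Path d) × Loc d => (q.1.2, q.2) := by fun_prop
    have := (measurable_correctingFactor μ PX K).comp h
    exact this
  · have h : Measurable fun q : (Path d × Path d) × Loc d => (q.1.1, q.2) := by fun_prop
    have := (measurable_path_uncurry.comp h).coe_nnreal_ennreal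
    exact this

lemma map_restrict_contributing (K : Set (Loc d)) (z : Path d × Path d) :
    ((stormIntensity μ PX z.1).restrict (Prod.mk z ⁻¹' contributing K)).map Prod.fst =
      centreIntensity μ PX K z.1 z.2 :=
  map_restrict_stormIntensity μ PX z.1 (H := fun q => supRatio K z.2 q.2 q.1)
    (measurable_supRatio_comp measurable_const measurable_snd measurable_fst K)

lemma supRatio_eq_zero {K : Set (Loc d)} {R : ℝ} {C : ℝ≥0} {f : Path d}
    (hf : ∀ s, f s ≤ (Metric.closedBall (0 : Loc d) R).indicator (fun _ => C) s)
    (y : Path d) {s : Loc d} (hs : s ∉ K + Metric.closedBall (0 : Loc d) R) :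
    supRatio K y f s = 0 := by
  simp only [supRatio, ENNReal.iSup_eq_zero]
  intro t ht
  have hts : t - s ∉ Metric.closedBall (0 : Loc d) R := by
    intro h
    refine hs (mem_add.2 ⟨t, ht, -(t - s), ?_, by abel⟩)
    simpa [norm_neg, norm_sub_rev] using h
  have h0 : f (t - s) = 0 := by
    have := hf (t - s)
    rwa [indicator_of_notMem hts, le_zero_iff] at this
  simp [h0]

variable {C : ℝ≥0} {R : ℝ}

omit [IsProbabilityMeasure PX] in
lemma correctingFactor_eq_zero
    (hbdd : ∀ᵐ f ∂PX, ∀ s, f s ≤ (Metric.closedBall (0 : Loc d) R).indicator (fun _ => C) s)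
    {K : Set (Loc d)} (y : Path d) {s : Loc d} (hs : s ∉ K + Metric.closedBall (0 : Loc d) R) :
    correctingFactor μ PX K y s = 0 := by
  rw [correctingFactor, lintegral_congr_ae (g := fun _ => 0), lintegral_zero, mul_zero]
  filter_upwards [hbdd] with f hf
  exact supRatio_eq_zero hf y hs

lemma isCompact_add_closedBall {K : Set (Loc d)} (hK : IsCompact K) :
    IsCompact (K + Metric.closedBall (0 : Loc d) R) := hK.add (isCompact_closedBall _ _)

omit [IsProbabilityMeasure PX] in
lemma tsupport_correctingFactor_subset
    (hbdd : ∀ᵐ f ∂PX, ∀ s, f s ≤ (Metric.closedBall (0 : Loc d) R).indicator (fun _ => C) s)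
    {K : Set (Loc d)} (hK : IsCompact K) (y : Path d) :
    tsupport (correctingFactor μ PX K y) ⊆ K + Metric.closedBall (0 : Loc d) R := by
  refine closure_minimal (fun s hs => ?_) (isCompact_add_closedBall hK).isClosed
  by_contra h
  exact hs (correctingFactor_eq_zero μ PX hbdd y h)

omit [IsProbabilityMeasure PX] in
lemma centreIntensity_compl_eq_zero
    (hbdd : ∀ᵐ f ∂PX, ∀ s, f s ≤ (Metric.closedBall (0 : Loc d) R).indicator (fun _ => C) s)
    {K : Set (Loc d)} (hK : IsCompact K) (ψ y : Path d) :
    centreIntensity μ PX K ψ y (K + Metric.closedBall (0 : Loc d) R)ᶜ = 0 := by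
  have hm := (isCompact_add_closedBall (R := R) hK).measurableSet.compl
  rw [centreIntensity, withDensity_apply _ hm, setLIntegral_congr_fun hm (g := fun _ => 0),
    lintegral_zero]
  intro s hs
  simp [correctingFactor_eq_zero μ PX hbdd y hs]

/-- By compactness `y ≥ ε > 0` on `K` and `ψ ≤ M` on `B`, so the density is at most `μ⁻¹ (C / ε) M`
on `B`. -/
lemma centreIntensity_lt_top (hμ : 0 < μ)
    (hbdd : ∀ᵐ f ∂PX, ∀ s, f s ≤ (Metric.closedBall (0 : Loc d) R).indicator (fun _ => C) s)
    {K : Set (Loc d)} (hK : IsCompact K) (ψ : Path d) {y : Path d} (hy : ∀ t ∈ K, 0 < y t)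
    {B : Set (Loc d)} (hB : IsCompact B) :
    centreIntensity μ PX K ψ y B < ∞ := by
  obtain ⟨ε, hε, hyε⟩ : ∃ ε : ℝ≥0, 0 < ε ∧ ∀ t ∈ K, ε ≤ y t := by
    rcases K.eq_empty_or_nonempty with rfl | hne
    · exact ⟨1, one_pos, by simp⟩
    · obtain ⟨t, ht, hmin⟩ := hK.exists_isMinOn hne y.continuous.continuousOn
      exact ⟨y t, hy t ht, fun s hs => hmin hs⟩
  obtain ⟨M, hM⟩ := exists_bound_path ψ hB
  have hb : ∀ s, correctingFactor μ PX K y s ≤ (μ : ℝ≥0∞)⁻¹ * (C / ε) := by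
    intro s
    rw [correctingFactor]
    gcongr
    calc ∫⁻ f, supRatio K y f s ∂PX ≤ ∫⁻ _, (C / ε : ℝ≥0∞) ∂PX := by
          refine lintegral_mono_ae ?_
          filter_upwards [hbdd] with f hf
          refine iSup₂_le fun t ht => ENNReal.div_le_div ?_ ?_
          · refine ENNReal.coe_le_coe.2 ((hf _).trans ?_)
            exact indicator_le_self' (fun _ _ => zero_le) _
          · exact ENNReal.coe_le_coe.2 (hyε t ht)
      _ = C / ε := by simp
  rw [centreIntensity, withDensity_apply _ hB.measurableSet]
  calc ∫⁻ s in B, correctingFactor μ PX K y s * ψ s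
      ≤ ∫⁻ s in B, (μ : ℝ≥0∞)⁻¹ * (C / ε) * M := by
        refine setLIntegral_mono' hB.measurableSet fun s hs => ?_
        have := hM s hs
        have := hb s
        gcongr
    _ < ∞ := by
        rw [setLIntegral_const]
        have hμ' : (μ : ℝ≥0∞)⁻¹ ≠ ∞ := ENNReal.inv_ne_top.2 (by exact_mod_cast hμ.ne')
        have hε' : (C / ε : ℝ≥0∞) ≠ ∞ :=
          ENNReal.div_ne_top ENNReal.coe_ne_top (by exact_mod_cast hε.ne')
        exact ENNReal.mul_lt_top (by finiteness) hB.measure_lt_top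

/-- This is a pathwise identity, term by term in the sum. The coordinate `ψ` is a dummy, since
`contributing` looks only at `y` and the storm. -/
lemma map_restrict_stormProcess {Ω : Type*} (ξ : ℕ → Ω → Storm d) (K : Set (Loc d))
    (Ystar : Ω → Path d) (ψ : Path d) (ω : Ω) :
    ((stormProcess ξ ω).restrict (Prod.mk (ψ, Ystar ω) ⁻¹' contributing K)).map Prod.fst =
      contributingCentres ξ K Ystar ω := by
  have hm : MeasurableSet (Prod.mk (ψ, Ystar ω) ⁻¹' contributing K) :=
    measurable_prodMk_left (measurableSet_contributing K)
  rw [stormProcess, Measure.restrict_sum _ hm, Measure.map_sum measurable_fst.aemeasurable,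
    contributingCentres]
  congr 1
  ext1 i
  classical
  rw [restrict_dirac' hm]
  have : (ξ i ω ∈ Prod.mk (ψ, Ystar ω) ⁻¹' contributing K) ↔
      ((ξ i ω).2.1 : ℝ≥0∞)⁻¹ ≤ supRatio K (Ystar ω) (ξ i ω).2.2 (ξ i ω).1 := Iff.rfl
  simp only [this]
  split_ifs with h
  · rw [Measure.map_dirac' measurable_fst]
  · simp

end Storms

/-! ### Conditional distributions -/

section CondDistrib

variable {Ω 𝓧 𝓨 𝓩 : Type*} [MeasurableSpace Ω] [MeasurableSpace 𝓧] [MeasurableSpace 𝓨]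
  [MeasurableSpace 𝓩] {P : Measure Ω} [IsProbabilityMeasure P]
  {X : Ω → 𝓧} {Y : Ω → 𝓨} {κ : Kernel 𝓧 𝓨} [IsMarkovKernel κ]

omit [IsProbabilityMeasure P] [IsMarkovKernel κ] in
lemma ae_of_hasCondDistrib (h : HasCondDistrib Y X κ P) {p : 𝓧 × 𝓨 → Prop}
    (hp : MeasurableSet {q | p q}) (hae : ∀ᵐ x ∂(P.map X), ∀ᵐ y ∂(κ x), p (x, y)) :
    ∀ᵐ ω ∂P, p (X ω, Y ω) := by
  refine ae_of_ae_map h.aemeasurable (p := p) ?_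
  rw [h.map_eq]
  exact Measure.ae_compProd_of_ae_ae hp hae

/-- A functional of the conditioning variable and the conditioned one. -/
lemma hasCondDistrib_map_prod (h : HasCondDistrib Y X κ P) {f : 𝓧 × 𝓨 → 𝓩} (hf : Measurable f) :
    HasCondDistrib (fun ω => f (X ω, Y ω)) X ((Kernel.id ×ₖ κ).map f) P := by
  have := Kernel.IsMarkovKernel.map (Kernel.id ×ₖ κ) hf
  have hX := h.aemeasurable_fst
  have hXY := h.aemeasurable
  refine ⟨hX.prodMk (hf.comp_aemeasurable hXY), ?_⟩
  have hg : Measurable fun q : 𝓧 × 𝓨 => (q.1, f q) := measurable_fst.prodMk hf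
  have h1 : P.map (fun ω => (X ω, f (X ω, Y ω)))
      = (P.map fun ω => (X ω, Y ω)).map fun q => (q.1, f q) := by
    rw [AEMeasurable.map_map_of_aemeasurable hg.aemeasurable hXY]
    rfl
  have := Measure.isProbabilityMeasure_map hX
  rw [h1, h.map_eq]
  ext s hs
  rw [Measure.map_apply hg hs, Measure.compProd_apply (hg hs), Measure.compProd_apply hs]
  refine lintegral_congr fun x => ?_
  rw [Kernel.map_apply _ hf, Kernel.prod_apply, Kernel.id_apply, Measure.dirac_prod,
    Measure.map_map hf measurable_prodMk_left,
    Measure.map_apply (hf.comp measurable_prodMk_left) (measurable_prodMk_left hs)]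
  rfl

/-- If `Z` and `Y` are conditionally independent given `X` then the conditional distribution of `Y`
given `(X, Z)` is the one given `X`. -/
lemma hasCondDistrib_of_condIndepGiven {Z : Ω → 𝓩} (hX : Measurable X) (hY : Measurable Y)
    (hZ : Measurable Z) (h : HasCondDistrib Y X κ P)
    (hind : CondIndepGiven (MeasurableSpace.comap X inferInstance)
      (MeasurableSpace.comap Z inferInstance) (MeasurableSpace.comap Y inferInstance) P) :
    HasCondDistrib Y (fun ω => (X ω, Z ω)) (Kernel.prodMkRight 𝓩 κ) P := by
  have hXZ : Measurable fun ω => (X ω, Z ω) := hX.prodMk hZ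
  have := Measure.isProbabilityMeasure_map (μ := P) hXZ.aemeasurable
  have := Measure.isProbabilityMeasure_map (μ := P) hX.aemeasurable
  have := Measure.isProbabilityMeasure_map (μ := P) (hXZ.prodMk hY).aemeasurable
  refine ⟨(hXZ.prodMk hY).aemeasurable, Measure.ext_prod₃_iff'.2 ?_⟩
  intro a c b ha hc hb
  have hm : MeasurableSpace.comap X inferInstance ≤ (inferInstance : MeasurableSpace Ω) :=
    hX.comap_le
  have ham : MeasurableSet[MeasurableSpace.comap X inferInstance] (X ⁻¹' a) := ⟨a, ha, rfl⟩
  have hA : MeasurableSet (Z ⁻¹' c) := hZ hc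
  have hB : MeasurableSet (Y ⁻¹' b) := hY hb
  have hκb : Measurable fun x => (κ x).real b :=
    (Kernel.measurable_coe κ hb).ennreal_toReal
  set g : Ω → ℝ := fun ω => (κ (X ω)).real b with hg
  have hgm : StronglyMeasurable[MeasurableSpace.comap X inferInstance] g :=
    (hκb.comp (comap_measurable X)).stronglyMeasurable
  have hg1 : ∀ ω, ‖g ω‖ ≤ 1 := fun ω => by
    rw [Real.norm_of_nonneg measureReal_nonneg]
    exact measureReal_le_one
  have hgi : Integrable g P :=
    Integrable.of_bound (hgm.mono hm).aestronglyMeasurable 1 (Eventually.of_forall hg1)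
  have hint : ∀ {s : Set Ω}, MeasurableSet s → Integrable (s.indicator fun _ => (1 : ℝ)) P :=
    fun hs => (integrable_const _).indicator hs
  have hset : ∀ {a : Set 𝓧}, MeasurableSet a →
      ∫⁻ ω in X ⁻¹' a, κ (X ω) b ∂P = P (X ⁻¹' a ∩ Y ⁻¹' b) := by
    intro a ha
    have h1 : P (X ⁻¹' a ∩ Y ⁻¹' b) = P.map (fun ω => (X ω, Y ω)) (a ×ˢ b) := by
      rw [Measure.map_apply (hX.prodMk hY) (ha.prod hb)]
      rfl
    rw [h1, h.map_eq, Measure.compProd_apply_prod ha hb,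
      setLIntegral_map ha (Kernel.measurable_coe κ hb) hX]
  -- The kernel, evaluated along `X`, is a version of the conditional probability of `Y ∈ b`; this
  -- links `HasCondDistrib` to the conditional expectations in `CondIndepGiven`.
  have hcondB : g =ᵐ[P] P⟦Y ⁻¹' b | MeasurableSpace.comap X inferInstance⟧ := by
    refine ae_eq_condExp_of_forall_setIntegral_eq hm (hint hB) (fun _ _ _ => hgi.integrableOn) ?_
      hgm.aestronglyMeasurable
    rintro _ ⟨a', ha', rfl⟩ -
    rw [hg]
    simp only [measureReal_def]
    have hκX : Measurable fun ω => κ (X ω) b := (Kernel.measurable_coe κ hb).comp hX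
    rw [integral_toReal hκX.aemeasurable (Eventually.of_forall fun ω => measure_lt_top _ _), hset ha',
      setIntegral_indicator hB, setIntegral_const, smul_eq_mul, mul_one, measureReal_def]
  have hfg : Integrable ((Z ⁻¹' c).indicator (fun _ => (1 : ℝ)) * g) P :=
    (hint hA).mul_bdd (hgm.mono hm).aestronglyMeasurable (Eventually.of_forall hg1)
  -- Conditional independence factorises the left side, and the `X`-measurable factor `g` is then
  -- pulled back inside the conditional expectation.
  have hchain : P⟦Z ⁻¹' c ∩ Y ⁻¹' b | MeasurableSpace.comap X inferInstance⟧ =ᵐ[P]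
      P[(Z ⁻¹' c).indicator (fun _ => (1 : ℝ)) * g | MeasurableSpace.comap X inferInstance] := by
    refine (hind _ _ ⟨c, hc, rfl⟩ ⟨b, hb, rfl⟩).trans ?_
    refine EventuallyEq.trans ?_ (condExp_mul_of_stronglyMeasurable_right hgm hfg (hint hA)).symm
    filter_upwards [hcondB] with ω hω
    rw [Pi.mul_apply, Pi.mul_apply, hω]
  have hreal : P.real (X ⁻¹' a ∩ (Z ⁻¹' c ∩ Y ⁻¹' b)) = ∫ ω in X ⁻¹' a ∩ Z ⁻¹' c, g ω ∂P := by
    calc P.real (X ⁻¹' a ∩ (Z ⁻¹' c ∩ Y ⁻¹' b))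
        = ∫ ω in X ⁻¹' a, (Z ⁻¹' c ∩ Y ⁻¹' b).indicator (fun _ => (1 : ℝ)) ω ∂P := by
          rw [setIntegral_indicator (hA.inter hB), setIntegral_const, smul_eq_mul, mul_one]
      _ = ∫ ω in X ⁻¹' a, ((Z ⁻¹' c).indicator (fun _ => (1 : ℝ)) * g) ω ∂P := by
          rw [← setIntegral_condExp hm (hint (hA.inter hB)) ham, ← setIntegral_condExp hm hfg ham]
          exact integral_congr_ae (ae_restrict_of_ae hchain)
      _ = ∫ ω in X ⁻¹' a, (Z ⁻¹' c).indicator g ω ∂P := by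
          congr 1
          ext ω
          by_cases hω : ω ∈ Z ⁻¹' c <;> simp [hω]
      _ = _ := setIntegral_indicator hA
  have hpre : (fun ω => ((X ω, Z ω), Y ω)) ⁻¹' ((a ×ˢ c) ×ˢ b)
      = X ⁻¹' a ∩ (Z ⁻¹' c ∩ Y ⁻¹' b) := by
    ext ω; simp [and_assoc]
  have hpre2 : (fun ω => (X ω, Z ω)) ⁻¹' (a ×ˢ c) = X ⁻¹' a ∩ Z ⁻¹' c := rfl
  rw [Measure.map_apply (hXZ.prodMk hY) ((ha.prod hc).prod hb), hpre,
    Measure.compProd_apply_prod (ha.prod hc) hb,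
    setLIntegral_map (ha.prod hc) (Kernel.measurable_coe _ hb) hXZ, hpre2]
  simp only [Kernel.prodMkRight_apply]
  rw [← ofReal_measureReal, hreal, hg]
  rw [ofReal_integral_eq_lintegral_ofReal hgi.integrableOn
    (Eventually.of_forall fun ω => measureReal_nonneg)]
  refine lintegral_congr fun ω => ?_
  exact ofReal_measureReal

end CondDistrib

/-! ### Density of random measures -/

section Density

variable {T : Type*} [MeasurableSpace T] [CountablyGenerated T] {D : ℕ → Set T}

/-- A version of the density with respect to `ρ`, jointly measurable in the measure and the
point. -/
def densityOf (hD : ∀ n, MeasurableSet (D n)) (ρ : Measure T) (q : Measure T × T) : ℝ≥0∞ :=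
  ∑' i : ℕ × ℕ, Kernel.rnDeriv (cutPiece hD i.1 i.2) (Kernel.const _ ρ) q.1 q.2

lemma measurable_densityOf (hD : ∀ n, MeasurableSet (D n)) (ρ : Measure T) :
    Measurable (densityOf hD ρ) :=
  Measurable.tsum fun _ => Kernel.measurable_rnDeriv _ _

/-- Each `cutPiece` is a finite kernel in `lam`, hence has a jointly measurable derivative against
the constant kernel `ρ`; the pieces sum to `lam`, and so do their densities. -/
lemma withDensity_densityOf (hD : ∀ n, MeasurableSet (D n))
    (hdisj : Pairwise (Function.onFun Disjoint D)) (hcov : ⋃ n, D n = univ)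
    (ρ : Measure T) [IsFiniteMeasure ρ] {lam : Measure T} (hfin : ∀ n, lam (D n) < ∞)
    (hac : ∀ n k, cutPiece hD n k lam ≪ ρ) :
    ρ.withDensity (fun x => densityOf hD ρ (lam, x)) = lam := by
  have h1 : (fun x => densityOf hD ρ (lam, x)) = ∑' i : ℕ × ℕ,
      Kernel.rnDeriv (cutPiece hD i.1 i.2) (Kernel.const _ ρ) lam := by
    ext x
    rw [ENNReal.tsum_apply]
    rfl
  rw [h1, withDensity_tsum fun i => Kernel.measurable_rnDeriv_right _ _ _]
  conv_rhs => rw [← cut_apply hD hdisj hcov hfin, cut, Kernel.sum_apply]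
  congr 1
  ext1 i
  rw [← Kernel.withDensity_rnDeriv_eq (η := Kernel.const _ ρ) (a := lam) (hac i.1 i.2),
    Kernel.withDensity_apply _ (Kernel.measurable_rnDeriv _ _), Kernel.const_apply]

omit [CountablyGenerated T] in
lemma cutPiece_le (hD : ∀ n, MeasurableSet (D n)) (n k : ℕ) (lam : Measure T) :
    cutPiece hD n k lam ≤ lam := by
  change (if _ then lam.restrict (D n) else 0 : Measure T) ≤ _
  split_ifs
  · exact Measure.restrict_le_self
  · exact Measure.zero_le _

end Density

/-! ### Positivity of the extremal field -/

/-- All `B n` being empty is at most as likely as a single one being empty, which has probability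
`exp (-lam (B n))`, tending to zero. -/
lemma ae_exists_ne_zero_of_tendsto_top {S : Type*} [TopologicalSpace S] [MeasurableSpace S]
    {lam : Measure S} {Q : Measure (Measure S)} (h : IsPoissonLaw lam Q) {B : ℕ → Set S}
    (hB : ∀ n, MeasurableSet (B n)) (hfin : ∀ n, lam (B n) < ∞)
    (htop : Tendsto (fun n => lam (B n)) atTop (𝓝 ∞)) : ∀ᵐ ν ∂Q, ∃ n, ν (B n) ≠ 0 := by
  have hle : ∀ n, Q {ν | ¬ ∃ n, ν (B n) ≠ 0}
      ≤ ENNReal.ofReal (Real.exp (-(lam (B n)).toNNReal)) := by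
    intro n
    rw [← measure_eq_zero_of_hasLaw_poisson (h.counts _ (hB n) (hfin n))]
    refine measure_mono fun ν hν => ?_
    simp only [mem_ofPred_eq, not_exists, not_not] at hν
    exact hν n
  have hreal : Tendsto (fun n => (((lam (B n)).toNNReal : ℝ≥0) : ℝ)) atTop atTop := by
    refine tendsto_atTop.2 fun b => ?_
    filter_upwards [htop.eventually (lt_mem_nhds (ENNReal.coe_lt_top (r := b.toNNReal)))] with n hn
    rw [← ENNReal.coe_toNNReal (hfin n).ne, ENNReal.coe_lt_coe] at hn
    exact (Real.le_coe_toNNReal b).trans (by exact_mod_cast hn.le)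
  have hlim : Tendsto (fun n => ENNReal.ofReal (Real.exp (-((lam (B n)).toNNReal : ℝ)))) atTop
      (𝓝 0) := by
    have := ENNReal.tendsto_ofReal (Real.tendsto_exp_neg_atTop_nhds_zero.comp hreal)
    simpa using this
  exact le_antisymm (ge_of_tendsto' hlim hle) zero_le

section Positivity

variable {d : ℕ} (μ : ℝ≥0) (PX : Measure (Path d)) [IsProbabilityMeasure PX]

/-- Shapes which are positive on the closed ball of radius `r`. -/
def positiveShapes (d : ℕ) (r : ℝ) : Set (Path d) :=
  {f | Metric.closedBall (0 : Loc d) r ⊆ {s | 0 < f s}}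

lemma measurableSet_positiveShapes (r : ℝ) : MeasurableSet (positiveShapes d r) :=
  (ContinuousMap.isOpen_setOfPred_mapsTo (isCompact_closedBall (0 : Loc d) r)
    (isOpen_Ioi (a := (0 : ℝ≥0)))).measurableSet

/-- Storms centred near `x`, with severity at least `1 / n`, which are positive near their
centre. -/
def positiveStorms (x : Loc d) (r : ℝ) (n : ℕ) : Set (Storm d) :=
  Metric.closedBall x (r / 2) ×ˢ ({u : Severity | (u : ℝ≥0∞)⁻¹ ≤ n} ×ˢ positiveShapes d r)

lemma measurableSet_positiveStorms (x : Loc d) (r : ℝ) (n : ℕ) :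
    MeasurableSet (positiveStorms x r n) :=
  Metric.isClosed_closedBall.measurableSet.prod
    ((measurableSet_le (by fun_prop) measurable_const).prod (measurableSet_positiveShapes r))

lemma stormIntensity_positiveStorms (ψ x : _) (r : ℝ) (n : ℕ) :
    stormIntensity μ PX ψ (positiveStorms x r n) =
      (∫⁻ s in Metric.closedBall x (r / 2), (μ : ℝ≥0∞)⁻¹ * (ψ s : ℝ≥0∞)) *
        (n * PX (positiveShapes d r)) := by
  rw [stormIntensity, positiveStorms, Measure.prod_prod, Measure.prod_prod, severityMeasure_inv_le,
    withDensity_apply _ Metric.isClosed_closedBall.measurableSet]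

/-- Lowering the severity threshold to `1 / n` gives intensity `n` times a fixed positive finite
constant, because `u⁻² du` has infinite mass near zero. -/
lemma ae_exists_positiveStorm (hμ : 0 < μ) {ψ : Path d} (hψ : ∀ s, 0 < ψ s) {r : ℝ} (hr : 0 < r)
    (hG : 0 < PX (positiveShapes d r)) {Q : Measure (Measure (Storm d))}
    (h : IsPoissonLaw (stormIntensity μ PX ψ) Q) (x : Loc d) :
    ∀ᵐ ν ∂Q, ∃ n, ν (positiveStorms x r n) ≠ 0 := by
  have hcomp : IsCompact (Metric.closedBall x (r / 2)) := isCompact_closedBall _ _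
  have hμ' : (μ : ℝ≥0∞)⁻¹ ≠ ∞ := ENNReal.inv_ne_top.2 (by exact_mod_cast hμ.ne')
  have hμ0 : (μ : ℝ≥0∞)⁻¹ ≠ 0 := ENNReal.inv_ne_zero.2 ENNReal.coe_ne_top
  have hI0 : ∫⁻ s in Metric.closedBall x (r / 2), (μ : ℝ≥0∞)⁻¹ * (ψ s : ℝ≥0∞) ≠ 0 := by
    have hpos := setLIntegral_pos_iff (μ := volume) (s := Metric.closedBall x (r / 2))
      (f := fun s => (μ : ℝ≥0∞)⁻¹ * (ψ s : ℝ≥0∞))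
      ((measurable_path ψ).coe_nnreal_ennreal.const_mul _)
    refine (hpos.2 ?_).ne'
    have : (Function.support fun s => (μ : ℝ≥0∞)⁻¹ * (ψ s : ℝ≥0∞)) = univ :=
      eq_univ_of_forall fun s => mul_ne_zero hμ0 (by exact_mod_cast (hψ s).ne')
    rw [this, univ_inter]
    exact Metric.measure_closedBall_pos _ _ (by positivity)
  have hItop : ∫⁻ s in Metric.closedBall x (r / 2), (μ : ℝ≥0∞)⁻¹ * (ψ s : ℝ≥0∞) ≠ ∞ := by
    obtain ⟨M, hM⟩ := exists_bound_path ψ hcomp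
    refine ne_top_of_le_ne_top (b := ∫⁻ s in Metric.closedBall x (r / 2), (μ : ℝ≥0∞)⁻¹ * M) ?_
      (setLIntegral_mono' hcomp.measurableSet fun s hs => ?_)
    · rw [setLIntegral_const]
      exact (ENNReal.mul_lt_top (by finiteness) hcomp.measure_lt_top).ne
    · have := hM s hs
      gcongr
  refine ae_exists_ne_zero_of_tendsto_top h (measurableSet_positiveStorms x r) (fun n => ?_) ?_
  · rw [stormIntensity_positiveStorms]
    exact ENNReal.mul_lt_top hItop.lt_top
      (ENNReal.mul_lt_top (ENNReal.natCast_lt_top n) (measure_lt_top _ _))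
  · simp_rw [stormIntensity_positiveStorms]
    have h1 : Tendsto (fun n : ℕ => (n : ℝ≥0∞) * PX (positiveShapes d r)) atTop (𝓝 ∞) := by
      have := ENNReal.Tendsto.mul_const (b := PX (positiveShapes d r))
        ENNReal.tendsto_nat_nhds_top (Or.inl ENNReal.top_ne_zero)
      rwa [ENNReal.top_mul hG.ne'] at this
    have h2 := ENNReal.Tendsto.const_mul h1 (Or.inl ENNReal.top_ne_zero)
      (a := ∫⁻ s in Metric.closedBall x (r / 2), (μ : ℝ≥0∞)⁻¹ * (ψ s : ℝ≥0∞))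
    rwa [ENNReal.mul_top hI0] at h2

variable {Ω : Type*}

/-- The radii `r / 2` for the centre and for `t` add up to `r`, where the shape has a positive
minimum by compactness. One storm thus bounds the field below uniformly on the ball. -/
lemma exists_le_extremalField {ξ : ℕ → Ω → Storm d} {ω : Ω} {x : Loc d} {r : ℝ} {n : ℕ}
    (hr : 0 < r) (h : stormProcess ξ ω (positiveStorms x r n) ≠ 0) :
    ∃ k : ℕ, ∀ t ∈ Metric.ball x (r / 2), (k : ℝ≥0∞)⁻¹ ≤ extremalField ξ ω t := by
  have hm := measurableSet_positiveStorms x r n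
  obtain ⟨i, hi⟩ : ∃ i, ξ i ω ∈ positiveStorms x r n := by
    by_contra! hno
    refine h ?_
    rw [stormProcess, Measure.sum_apply _ hm, ENNReal.tsum_eq_zero]
    intro i
    rw [Measure.dirac_apply' _ hm, indicator_of_notMem (hno i)]
  obtain ⟨hs, hu, hf⟩ := hi
  set f := (ξ i ω).2.2
  obtain ⟨z, hz, hmin⟩ := (isCompact_closedBall (0 : Loc d) r).exists_isMinOn
    ⟨0, Metric.mem_closedBall_self hr.le⟩ f.continuous.continuousOn
  have hpos : 0 < f z := hf hz
  have hu' : (n : ℝ≥0∞)⁻¹ ≤ ((ξ i ω).2.1 : ℝ≥0∞) := ENNReal.inv_le_iff_inv_le.1 hu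
  have hlow : (n : ℝ≥0∞)⁻¹ * f z ≠ 0 :=
    mul_ne_zero (ENNReal.inv_ne_zero.2 (ENNReal.natCast_ne_top n)) (by exact_mod_cast hpos.ne')
  obtain ⟨k, hk⟩ := ENNReal.exists_inv_nat_lt hlow
  refine ⟨k, fun t ht => ?_⟩
  have hts : t - (ξ i ω).1 ∈ Metric.closedBall (0 : Loc d) r := by
    rw [mem_closedBall_zero_iff, ← dist_eq_norm]
    have h1 := dist_triangle_right t (ξ i ω).1 x
    have h2 : dist t x < r / 2 := ht
    have h3 : dist (ξ i ω).1 x ≤ r / 2 := hs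
    linarith
  calc (k : ℝ≥0∞)⁻¹ ≤ (n : ℝ≥0∞)⁻¹ * f z := hk.le
    _ ≤ ((ξ i ω).2.1 : ℝ≥0∞) * (f (t - (ξ i ω).1) : ℝ≥0∞) := by
        have := hmin hts
        gcongr
        exact_mod_cast this
    _ ≤ extremalField ξ ω t := le_iSup
        (fun i => ((ξ i ω).2.1 : ℝ≥0∞) * ((ξ i ω).2.2 (t - (ξ i ω).1) : ℝ≥0∞)) i

lemma measurableSet_strictlyPositive : MeasurableSet {y : Path d | ∀ s, 0 < y s} := by
  have : {y : Path d | ∀ s, 0 < y s} = ⋂ n : ℕ, positiveShapes d n := by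
    ext y
    simp only [mem_ofPred_eq, mem_iInter, positiveShapes, subset_def]
    refine ⟨fun h n s _ => h s, fun h s => ?_⟩
    obtain ⟨n, hn⟩ := exists_nat_ge ‖s‖
    exact h n s (mem_closedBall_zero_iff.2 hn)
  rw [this]
  exact MeasurableSet.iInter fun n => measurableSet_positiveShapes _

variable [MeasurableSpace Ω] {P : Measure Ω}

/-- A copy of the extremal field with continuous paths is strictly positive. -/
lemma ae_forall_pos_of_identDistrib (hμ : 0 < μ) {Ψ : Ω → Path d} (hΨ : Measurable Ψ)
    (hΨpos : ∀ᵐ ω ∂P, ∀ s, 0 < Ψ ω s) {ξ : ℕ → Ω → Storm d}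
    (hN : IsCondPoisson (stormProcess ξ) Ψ (stormIntensity μ PX) P)
    (hsupp : ∃ r : ℝ, 0 < r ∧ 0 < PX (positiveShapes d r))
    {Ystar : Ω → Path d}
    (hcopy : IdentDistrib (fun ω => (Ψ ω, fun t => (Ystar ω t : ℝ≥0∞)))
      (fun ω => (Ψ ω, extremalField ξ ω)) P P) :
    ∀ᵐ ω ∂P, ∀ s, 0 < Ystar ω s := by
  obtain ⟨r, hr, hG⟩ := hsupp
  obtain ⟨κ, hκ, hpois, hcond⟩ := hN
  have hΨpos' : ∀ᵐ ψ ∂(P.map Ψ), ∀ s, 0 < ψ s :=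
    (ae_map_iff hΨ.aemeasurable measurableSet_strictlyPositive).2 hΨpos
  -- The identity in law concerns the product `σ`-algebra, so the uniform lower bound is transferred
  -- only on a countable dense set; continuity of `Y*` restores it everywhere.
  have hev : ∀ x : Loc d, MeasurableSet {q : Path d × (Loc d → ℝ≥0∞) |
      ∃ k : ℕ, ∀ t ∈ range (TopologicalSpace.denseSeq (Loc d)) ∩ Metric.ball x (r / 2),
        (k : ℝ≥0∞)⁻¹ ≤ q.2 t} := by
    intro x
    have : {q : Path d × (Loc d → ℝ≥0∞) |
      ∃ k : ℕ, ∀ t ∈ range (TopologicalSpace.denseSeq (Loc d)) ∩ Metric.ball x (r / 2),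
        (k : ℝ≥0∞)⁻¹ ≤ q.2 t} = ⋃ k : ℕ,
        ⋂ t ∈ range (TopologicalSpace.denseSeq (Loc d)) ∩ Metric.ball x (r / 2),
          {q : Path d × (Loc d → ℝ≥0∞) | (k : ℝ≥0∞)⁻¹ ≤ q.2 t} := by
      ext; simp
    rw [this]
    refine MeasurableSet.iUnion fun k => MeasurableSet.biInter
      ((countable_range _).mono inter_subset_left) fun t _ => measurableSet_le measurable_const ?_
    fun_prop
  have hY : ∀ x : Loc d, ∀ᵐ ω ∂P, ∃ k : ℕ,
      ∀ t ∈ range (TopologicalSpace.denseSeq (Loc d)) ∩ Metric.ball x (r / 2),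
        (k : ℝ≥0∞)⁻¹ ≤ (Ystar ω t : ℝ≥0∞) := by
    intro x
    refine hcopy.symm.ae_snd (hev x) ?_
    have hpm : MeasurableSet {q : Path d × Measure (Storm d) |
        ∃ n, q.2 (positiveStorms x r n) ≠ 0} := by
      have : {q : Path d × Measure (Storm d) | ∃ n, q.2 (positiveStorms x r n) ≠ 0}
          = ⋃ n, {q | q.2 (positiveStorms x r n) ≠ 0} := by ext; simp
      rw [this]
      refine MeasurableSet.iUnion fun n => ?_
      exact ((Measure.measurable_coe (measurableSet_positiveStorms x r n)).comp measurable_snd)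
        (measurableSet_singleton 0).compl
    have := ae_of_hasCondDistrib hcond
      (p := fun q => ∃ n, q.2 (positiveStorms x r n) ≠ 0) hpm (by
        filter_upwards [hpois, hΨpos'] with ψ hψ hψpos
        exact ae_exists_positiveStorm μ PX hμ hψpos hr hG hψ x)
    filter_upwards [this] with ω hω
    obtain ⟨n, hn⟩ := hω
    obtain ⟨k, hk⟩ := exists_le_extremalField hr hn
    exact ⟨k, fun t ht => hk t ht.2⟩
  have hYall := ae_all_iff.2 fun j : ℕ => hY (TopologicalSpace.denseSeq (Loc d) j)
  filter_upwards [hYall] with ω hω s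
  obtain ⟨j, hj⟩ := (TopologicalSpace.denseRange_denseSeq (Loc d)).exists_dist_lt s (half_pos hr)
  obtain ⟨k, hk⟩ := hω j
  have hcl : s ∈ closure (range (TopologicalSpace.denseSeq (Loc d)) ∩
      Metric.ball (TopologicalSpace.denseSeq (Loc d) j) (r / 2)) := by
    rw [inter_comm]
    exact Dense.open_subset_closure_inter (TopologicalSpace.denseRange_denseSeq (Loc d))
      Metric.isOpen_ball hj
  have hclosed : IsClosed {t : Loc d | (k : ℝ≥0∞)⁻¹ ≤ (Ystar ω t : ℝ≥0∞)} :=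
    isClosed_le continuous_const (ENNReal.continuous_coe.comp (Ystar ω).continuous)
  have hs : (k : ℝ≥0∞)⁻¹ ≤ (Ystar ω s : ℝ≥0∞) := closure_minimal hk hclosed hcl
  have hk0 : (0 : ℝ≥0∞) < (k : ℝ≥0∞)⁻¹ := ENNReal.inv_pos.2 (ENNReal.natCast_ne_top k)
  exact ENNReal.coe_pos.1 (hk0.trans_le hs)

end Positivity

/-! ### Poisson laws as a kernel in the directing measure -/

section Main

variable {d : ℕ} (μ : ℝ≥0) (PX : Measure (Path d)) [IsProbabilityMeasure PX]

lemma exists_subset_closedBall (C : Set (Loc d)) (hC : IsCompact C) :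
    ∃ m : ℕ, C ⊆ Metric.closedBall 0 (m : ℝ) := by
  obtain ⟨r, hr⟩ := hC.isBounded.subset_closedBall 0
  obtain ⟨m, hm⟩ := exists_nat_ge r
  exact ⟨m, hr.trans (Metric.closedBall_subset_closedBall hm)⟩

lemma iUnion_closedBall_natCast : ⋃ m : ℕ, Metric.closedBall (0 : Loc d) (m : ℝ) = univ :=
  Metric.iUnion_closedBall_nat 0

lemma monotone_closedBall_natCast : Monotone fun m : ℕ => Metric.closedBall (0 : Loc d) (m : ℝ) :=
  fun _ _ h => Metric.closedBall_subset_closedBall (by exact_mod_cast h)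

/-- The thinning kernel produces Poisson laws for the centres of the storms. -/
lemma isPoissonLaw_thinKernel {Z : Type*} [MeasurableSpace Z] (hd : 0 < d) (hμ : 0 < μ)
    {A : Set (Z × Storm d)} (hA : MeasurableSet A) (κ : Kernel Z (Measure (Storm d)))
    [IsMarkovKernel κ] {z : Z} {ψ : Path d} (h : IsPoissonLaw (stormIntensity μ PX ψ) (κ z))
    {lam : Measure (Loc d)}
    (hlam : ((stormIntensity μ PX ψ).restrict (Prod.mk z ⁻¹' A)).map Prod.fst = lam)
    (hfin : ∀ m : ℕ, lam (Metric.closedBall 0 (m : ℝ)) < ∞) (hac : lam ≪ volume) :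
    IsPoissonLaw lam (thinKernel measurableSet_stormCell A Prod.fst κ z) := by
  have : Nonempty (Fin d) := ⟨⟨0, hd⟩⟩
  rw [thinKernel_apply_eq_map_restrict measurableSet_stormCell pairwise_disjoint_stormCell
    iUnion_stormCell hA measurable_fst κ h (stormIntensity_stormCell_lt_top μ PX hμ ψ), ← hlam]
  refine h.map_restrict (measurable_prodMk_left hA) measurable_fst
    (E := fun m : ℕ => Metric.closedBall 0 (m : ℝ))
    (fun m => Metric.isClosed_closedBall.measurableSet) exists_subset_closedBall ?_ ?_
  · rwa [hlam]
  · rw [hlam]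
    exact fun x => hac (measure_singleton x)

/-- A partition of `ℝ^d` into bounded sets. -/
def locCell (d : ℕ) : ℕ → Set (Loc d) := disjointed fun m : ℕ => Metric.closedBall 0 (m : ℝ)

lemma measurableSet_locCell (n : ℕ) : MeasurableSet (locCell d n) :=
  MeasurableSet.disjointed (fun _ => Metric.isClosed_closedBall.measurableSet) n

/-- Measures which are finite on balls and absolutely continuous. -/
def regularMeasures (d : ℕ) : Set (Measure (Loc d)) :=
  {lam | (∀ m : ℕ, lam (Metric.closedBall 0 (m : ℝ)) < ∞) ∧
    ∀ n k, cutPiece measurableSet_locCell n k lam ≪ (volume : Measure (Loc d)).toFinite}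

/-- Absolute continuity between two finite kernels is a measurable condition on the parameter, hence
its formulation through `cutPiece` and a finite reference measure. -/
lemma measurableSet_regularMeasures : MeasurableSet (regularMeasures d) := by
  rw [regularMeasures, ofPred_and]
  refine MeasurableSet.inter ?_ ?_
  · have : {lam : Measure (Loc d) | ∀ m : ℕ, lam (Metric.closedBall 0 (m : ℝ)) < ∞}
        = ⋂ m : ℕ, {lam | lam (Metric.closedBall 0 (m : ℝ)) < ∞} := by ext; simp
    rw [this]
    exact MeasurableSet.iInter fun m =>
      Measure.measurable_coe Metric.isClosed_closedBall.measurableSet measurableSet_Iio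
  · have : {lam : Measure (Loc d) | ∀ n k, cutPiece measurableSet_locCell n k lam
        ≪ (volume : Measure (Loc d)).toFinite}
        = ⋂ n, ⋂ k, {lam | cutPiece measurableSet_locCell n k lam ≪
          Kernel.const (Measure (Loc d)) (volume : Measure (Loc d)).toFinite lam} := by
      ext; simp
    rw [this]
    exact MeasurableSet.iInter fun n => MeasurableSet.iInter fun k =>
      Kernel.measurableSet_absolutelyContinuous _ _

lemma mem_regularMeasures {lam : Measure (Loc d)}
    (hfin : ∀ m : ℕ, lam (Metric.closedBall 0 (m : ℝ)) < ∞) (hac : lam ≪ volume) :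
    lam ∈ regularMeasures d :=
  ⟨hfin, fun n k => ((cutPiece_le measurableSet_locCell n k lam).absolutelyContinuous.trans
    hac).trans (absolutelyContinuous_toFinite _)⟩

/-- The level of inverse severity below which the storms directed by `ψ` have to be kept for their
centres to be directed by `lam`. -/
def thinningLevel (μ : ℝ≥0) (ψ : Path d) (q : Measure (Loc d) × Loc d) : ℝ≥0∞ :=
  (volume : Measure (Loc d)).toFinite.rnDeriv volume q.2 *
    densityOf measurableSet_locCell (volume : Measure (Loc d)).toFinite q * (μ / ψ q.2)

lemma measurable_thinningLevel (ψ : Path d) : Measurable (thinningLevel μ ψ) := by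
  refine Measurable.mul (Measurable.mul ?_ (measurable_densityOf _ _)) ?_
  · exact (Measure.measurable_rnDeriv _ _).comp measurable_snd
  · exact measurable_const.div
      ((measurable_path ψ).coe_nnreal_ennreal.comp measurable_snd)

/-- The storms kept by `thinningLevel`, jointly in the directing measure and the storm. -/
def keptStorms (μ : ℝ≥0) (ψ : Path d) : Set (Measure (Loc d) × Storm d) :=
  {x | x.2 ∈ belowLevel fun q => thinningLevel μ ψ (x.1, q.1)}

lemma measurableSet_keptStorms (ψ : Path d) : MeasurableSet (keptStorms μ ψ) := by
  refine measurableSet_le (f := fun x : Measure (Loc d) × Storm d => (x.2.2.1 : ℝ≥0∞)⁻¹)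
    (by fun_prop) ?_
  have h : Measurable fun x : Measure (Loc d) × Storm d => (x.1, x.2.1) := by fun_prop
  have := (measurable_thinningLevel μ ψ).comp h
  exact this

lemma withDensity_densityOf_loc {lam : Measure (Loc d)} (h : lam ∈ regularMeasures d) :
    (volume : Measure (Loc d)).toFinite.withDensity (fun x =>
      densityOf measurableSet_locCell (volume : Measure (Loc d)).toFinite (lam, x)) = lam :=
  withDensity_densityOf measurableSet_locCell (disjoint_disjointed _)
    (by rw [locCell, iUnion_disjointed, iUnion_closedBall_natCast]) _
    (fun n => (measure_mono (disjointed_subset _ n)).trans_lt (h.1 n)) h.2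

/-- The factor `μ / ψ` in the level cancels the storm density `μ⁻¹ ψ`, which needs `ψ > 0`
everywhere. What remains is the density of `lam` against Lebesgue measure, by the chain rule through
the finite reference measure. -/
lemma map_restrict_keptStorms (hμ : 0 < μ) {ψ : Path d} (hψ : ∀ s, 0 < ψ s)
    {lam : Measure (Loc d)} (h : lam ∈ regularMeasures d) :
    ((stormIntensity μ PX ψ).restrict (Prod.mk lam ⁻¹' keptStorms μ ψ)).map Prod.fst = lam := by
  have hlev : Measurable fun q : Loc d × Path d => thinningLevel μ ψ (lam, q.1) := by
    have h1 : Measurable fun q : Loc d × Path d => (lam, q.1) := by fun_prop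
    have := (measurable_thinningLevel μ ψ).comp h1
    exact this
  refine (map_restrict_stormIntensity μ PX ψ hlev).trans ?_
  have hdens : Measurable fun x : Loc d =>
      densityOf measurableSet_locCell (volume : Measure (Loc d)).toFinite (lam, x) :=
    (measurable_densityOf _ _).comp measurable_prodMk_left
  have hcancel : ∀ s, (μ : ℝ≥0∞)⁻¹ * (∫⁻ _, thinningLevel μ ψ (lam, s) ∂PX) * ψ s =
      (volume : Measure (Loc d)).toFinite.rnDeriv volume s *
        densityOf measurableSet_locCell (volume : Measure (Loc d)).toFinite (lam, s) := by
    intro s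
    have hμ0 : (μ : ℝ≥0∞) ≠ 0 := by exact_mod_cast hμ.ne'
    have hψ0 : (ψ s : ℝ≥0∞) ≠ 0 := by exact_mod_cast (hψ s).ne'
    rw [lintegral_const, measure_univ, mul_one, thinningLevel]
    set a := (volume : Measure (Loc d)).toFinite.rnDeriv volume s *
        densityOf measurableSet_locCell (volume : Measure (Loc d)).toFinite (lam, s)
    calc (μ : ℝ≥0∞)⁻¹ * (a * (μ / ψ s)) * ψ s
        = ((μ : ℝ≥0∞)⁻¹ * μ) * ((ψ s : ℝ≥0∞)⁻¹ * ψ s) * a := by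
          rw [div_eq_mul_inv]; ring
      _ = a := by
          rw [ENNReal.inv_mul_cancel hμ0 ENNReal.coe_ne_top,
            ENNReal.inv_mul_cancel hψ0 ENNReal.coe_ne_top, one_mul, one_mul]
  simp_rw [hcancel]
  have := withDensity_mul (volume : Measure (Loc d))
    (Measure.measurable_rnDeriv (volume : Measure (Loc d)).toFinite volume) hdens
  refine this.trans ?_
  rw [Measure.withDensity_rnDeriv_eq _ _ (toFinite_absolutelyContinuous _)]
  exact withDensity_densityOf_loc h

variable {Ω : Type*} [MeasurableSpace Ω] {P : Measure Ω} [IsProbabilityMeasure P]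

/-- A conditionally Poisson process given `Z`, with regular directing measure, whose conditional
law is known, is a Cox process, provided that the Poisson laws of all regular measures form a
kernel. -/
lemma isCoxProcess_of_hasCondDistrib {Z : Type*} [MeasurableSpace Z]
    {N : Ω → Measure (Loc d)} {V : Ω → Z} {κ : Kernel Z (Measure (Loc d))} [IsMarkovKernel κ]
    {L : Z → Measure (Loc d)} (hL : Measurable L) (h : HasCondDistrib N V κ P)
    (hpois : ∀ᵐ z ∂(P.map V), IsPoissonLaw (L z) (κ z))
    (hreg : ∀ᵐ z ∂(P.map V), L z ∈ regularMeasures d)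
    {η : Kernel (Measure (Loc d)) (Measure (Loc d))} [IsMarkovKernel η]
    (hη : ∀ lam ∈ regularMeasures d, IsPoissonLaw lam (η lam)) :
    IsCoxProcess N (fun ω => L (V ω)) P := by
  have hV := h.aemeasurable_fst
  have hmap : P.map (fun ω => L (V ω)) = (P.map V).map L :=
    (AEMeasurable.map_map_of_aemeasurable hL.aemeasurable hV).symm
  refine ⟨η, inferInstance, ?_, ?_⟩
  · rw [hmap]
    have : ∀ᵐ lam ∂((P.map V).map L), lam ∈ regularMeasures d :=
      (ae_map_iff hL.aemeasurable measurableSet_regularMeasures).2 hreg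
    filter_upwards [this] with lam hlam using hη lam hlam
  · have := Measure.isProbabilityMeasure_map hV
    -- Both sides are Poisson laws with directing measure `L z`. The conditional law thus factors
    -- through `L`, and conditioning on `L (V ω)` instead of `V ω` is legitimate.
    have heq : κ =ᵐ[P.map V] η.comap L hL := by
      filter_upwards [hpois, hreg] with z hz hzr
      rw [Kernel.comap_apply]
      exact hz.unique (hη _ hzr) (fun m => Metric.isClosed_closedBall.measurableSet)
        monotone_closedBall_natCast iUnion_closedBall_natCast hzr.1
    have h' : HasCondDistrib N V (η.comap L hL) P :=
      ⟨h.aemeasurable, by rw [h.map_eq]; exact Measure.compProd_congr heq⟩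
    exact h'.comp_right

end Main

end CoxExtremal

end

open CoxExtremal Filter in
theorem mainTheorem4 {Ω : Type*} [mΩ : MeasurableSpace Ω] (P : Measure Ω) [IsProbabilityMeasure P]
    (d : ℕ) (hd : 0 < d)
    -- the law of the storm process, the scaling constant, the spatial intensity process
    (PX : Measure (CoxExtremal.Path d)) [IsProbabilityMeasure PX]
    (μ : ℝ≥0) (hμ : 0 < μ)
    (Ψ : Ω → CoxExtremal.Path d) (hΨ : Measurable Ψ)
    (hΨpos : ∀ᵐ ω ∂P, ∀ s, 0 < Ψ ω s)
    -- the storms: a Cox process directed by `μ⁻¹ Ψ(s) ds u⁻² du dP_X`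
    (ξ : ℕ → Ω → CoxExtremal.Storm d) (hξ : ∀ i, Measurable (ξ i))
    (hN : CoxExtremal.IsCondPoisson (CoxExtremal.stormProcess ξ) Ψ
      (CoxExtremal.stormIntensity μ PX) P)
    -- the shape is bounded with bounded support, and positive near the origin
    (C : ℝ≥0) (hC : 0 < C) (R : ℝ) (hR : 0 < R)
    (hbdd : ∀ᵐ f ∂PX, ∀ s, f s ≤ (Metric.closedBall (0 : CoxExtremal.Loc d) R).indicator
      (fun _ => C) s)
    (hsupp : ∃ r : ℝ, 0 < r ∧
      0 < PX {f | Metric.closedBall (0 : CoxExtremal.Loc d) r ⊆ {s | 0 < f s}})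
    -- given `Ψ`, the field `Y*` is a copy of `Y` which is independent of `N`
    (Ystar : Ω → CoxExtremal.Path d) (hYstar : Measurable Ystar)
    (hcopy : IdentDistrib (fun ω => (Ψ ω, fun t => (Ystar ω t : ℝ≥0∞)))
      (fun ω => (Ψ ω, CoxExtremal.extremalField ξ ω)) P P)
    (hindep : CoxExtremal.CondIndepGiven
      (MeasurableSpace.comap Ψ inferInstance)
      (MeasurableSpace.comap Ystar inferInstance)
      (MeasurableSpace.comap (CoxExtremal.stormProcess ξ) inferInstance) P)
    (K : Set (CoxExtremal.Loc d)) (hK : IsCompact K) :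
    -- `N_K^{Y*}` is a Cox process
    CoxExtremal.IsCoxProcess (CoxExtremal.contributingCentres ξ K Ystar)
        (fun ω => CoxExtremal.centreIntensity μ PX K (Ψ ω) (Ystar ω)) P ∧
    -- on `K_R`
    (∀ᵐ ω ∂P, CoxExtremal.contributingCentres ξ K Ystar ω
      (K + Metric.closedBall (0 : CoxExtremal.Loc d) R)ᶜ = 0) ∧
    -- conditionally on `Ψ = ψ`, `Y* = y` it is Poisson with intensity `b_K^y(s) ψ(s)`
    CoxExtremal.IsCondPoisson (CoxExtremal.contributingCentres ξ K Ystar)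
        (fun ω => (Ψ ω, Ystar ω))
        (fun z => CoxExtremal.centreIntensity μ PX K z.1 z.2) P ∧
    -- the support of `b_K^y` lies in `K_R`
    (∀ y : CoxExtremal.Path d, tsupport (CoxExtremal.correctingFactor μ PX K y) ⊆
      K + Metric.closedBall (0 : CoxExtremal.Loc d) R) := by
  have hYpos := ae_forall_pos_of_identDistrib μ PX hμ hΨ hΨpos hN hsupp hcopy
  obtain ⟨κ, hκ, hpois, hcond⟩ := hN
  set Z : Ω → Path d × Path d := fun ω => (Ψ ω, Ystar ω) with hZ
  have hZm : Measurable Z := hΨ.prodMk hYstar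
  have hNm : Measurable (stormProcess ξ) := by
    refine Measure.measurable_of_measurable_coe _ fun B hB => ?_
    simp_rw [stormProcess, Measure.sum_apply _ hB]
    exact Measurable.tsum fun i => (Measure.measurable_coe hB).comp
      (Measure.measurable_dirac.comp (hξ i))
  have hcond1 := hasCondDistrib_of_condIndepGiven hΨ hNm hYstar hcond hindep
  have hA := measurableSet_contributing K
  have hthin := hasCondDistrib_map_prod hcond1 (measurable_thin measurableSet_stormCell hA measurable_fst)
  have hpois1 : ∀ᵐ z ∂(P.map Z), IsPoissonLaw (stormIntensity μ PX z.1)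
      (Kernel.prodMkRight (Path d) κ z) := by
    have hfst : (P.map Z).map Prod.fst = P.map Ψ := Measure.map_map measurable_fst hZm
    exact ae_of_ae_map measurable_fst.aemeasurable (by rwa [hfst])
  have hpos1 : ∀ᵐ z ∂(P.map Z), ∀ s, 0 < z.2 s :=
    (ae_map_iff hZm.aemeasurable (measurable_snd measurableSet_strictlyPositive)).2 hYpos
  set κ' := thinKernel measurableSet_stormCell (contributing K) Prod.fst
    (Kernel.prodMkRight (Path d) κ) with hκ'
  have hκ'm : IsMarkovKernel κ' := isMarkovKernel_thinKernel _ hA measurable_fst _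
  have hfin : ∀ᵐ z ∂(P.map Z), ∀ m : ℕ,
      centreIntensity μ PX K z.1 z.2 (Metric.closedBall 0 (m : ℝ)) < ∞ := by
    filter_upwards [hpos1] with z hz m
    exact centreIntensity_lt_top μ PX hμ hbdd hK z.1 (fun t _ => hz t) (isCompact_closedBall _ _)
  have hac : ∀ z : Path d × Path d, centreIntensity μ PX K z.1 z.2 ≪ volume := fun z =>
    withDensity_absolutelyContinuous _ _
  have hpois' : ∀ᵐ z ∂(P.map Z), IsPoissonLaw (centreIntensity μ PX K z.1 z.2) (κ' z) := by
    filter_upwards [hpois1, hfin] with z hz hzfin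
    exact isPoissonLaw_thinKernel μ PX hd hμ hA _ hz (map_restrict_contributing μ PX K z) hzfin
      (hac z)
  -- The realised storm process is almost surely fixed by `cut`, so `thin` produces the contributing
  -- centres themselves.
  have hcells : ∀ᵐ ω ∂P, ∀ n, stormProcess ξ ω (stormCell d n) < ∞ := by
    refine ae_of_hasCondDistrib hcond
      (p := fun q : Path d × Measure (Storm d) => ∀ n, q.2 (stormCell d n) < ∞) ?_ ?_
    · have : {q : Path d × Measure (Storm d) | ∀ n, q.2 (stormCell d n) < ∞}
          = ⋂ n, {q | q.2 (stormCell d n) < ∞} := by ext; simp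
      rw [this]
      exact MeasurableSet.iInter fun n =>
        ((Measure.measurable_coe (measurableSet_stormCell n)).comp measurable_snd) measurableSet_Iio
    · filter_upwards [hpois] with ψ hψ
      refine ae_all_iff.2 fun n => ?_
      filter_upwards [ae_exists_nat_of_hasLaw_poisson (hψ.counts _ (measurableSet_stormCell n)
        (stormIntensity_stormCell_lt_top μ PX hμ ψ n))] with ν hν
      obtain ⟨k, hk⟩ := hν
      simp [hk]
  have hcc : contributingCentres ξ K Ystar =ᵐ[P] fun ω =>
      thin measurableSet_stormCell (contributing K) Prod.fst (Z ω, stormProcess ξ ω) := by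
    filter_upwards [hcells] with ω hω
    rw [thin, cut_apply _ pairwise_disjoint_stormCell iUnion_stormCell hω]
    exact (map_restrict_stormProcess ξ K Ystar (Ψ ω) ω).symm
  have hmain : HasCondDistrib (contributingCentres ξ K Ystar) Z κ' P := by
    refine HasLaw.congr hthin ?_
    filter_upwards [hcc] with ω hω
    rw [hω]
  refine ⟨?_, ?_, ⟨κ', hκ'm, hpois', hmain⟩, tsupport_correctingFactor_subset μ PX hbdd hK⟩
  · have := Measure.isProbabilityMeasure_map (μ := P) hΨ.aemeasurable
    have hΨpos' : ∀ᵐ ψ ∂(P.map Ψ), ∀ s, 0 < ψ s :=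
      (ae_map_iff hΨ.aemeasurable measurableSet_strictlyPositive).2 hΨpos
    -- A single positive `ψ` with a Poisson law `κ ψ` suffices: this one storm process is the source
    -- from which all regular directing measures are obtained by thinning.
    obtain ⟨ψ, hψpois, hψpos⟩ := (hpois.and hΨpos').exists
    have := hψpois.isProbabilityMeasure
    have hη := isMarkovKernel_thinKernel measurableSet_stormCell (measurableSet_keptStorms μ ψ)
      measurable_fst (Kernel.const (Measure (Loc d)) (κ ψ))
    refine isCoxProcess_of_hasCondDistrib (V := Z)
      (L := fun z => centreIntensity μ PX K z.1 z.2) (measurable_centreIntensity μ PX K) hmain hpois' ?_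
      (η := thinKernel measurableSet_stormCell (keptStorms μ ψ) Prod.fst
        (Kernel.const (Measure (Loc d)) (κ ψ))) fun lam hlam => ?_
    · filter_upwards [hfin] with z hz using mem_regularMeasures hz (hac z)
    · refine isPoissonLaw_thinKernel μ PX hd hμ (measurableSet_keptStorms μ ψ) _ (ψ := ψ)
        (by rwa [Kernel.const_apply]) (map_restrict_keptStorms μ PX hμ hψpos hlam) hlam.1 ?_
      rw [← withDensity_densityOf_loc hlam]
      exact (withDensity_absolutelyContinuous _ _).trans (toFinite_absolutelyContinuous _)
  · have hm : MeasurableSet (K + Metric.closedBall (0 : Loc d) R)ᶜ :=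
      (isCompact_add_closedBall hK).measurableSet.compl
    refine ae_of_hasCondDistrib hmain (p := fun q : (Path d × Path d) × Measure (Loc d) =>
      q.2 (K + Metric.closedBall (0 : Loc d) R)ᶜ = 0) ?_ ?_
    · exact ((Measure.measurable_coe hm).comp measurable_snd) (measurableSet_singleton 0)
    · filter_upwards [hpois'] with z hz
      have h0 := centreIntensity_compl_eq_zero μ PX hbdd hK z.1 z.2
      -- Zero intensity outside `K_R` makes the void probability there `exp 0 = 1`.
      have h1 := measure_eq_zero_of_hasLaw_poisson (hz.counts _ hm (by rw [h0]; simp))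
      rw [h0] at h1
      have := hz.isProbabilityMeasure
      refine (prob_compl_eq_zero_iff ?_).2 (by simpa using h1)
      exact Measure.measurable_coe hm (measurableSet_singleton 0)
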